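/- Let $V$ be a finite set of $n \ge 3$ cities, let $E$ be the edge set of the complete undirected graph on $V$, and let $c : E \to \{1,2\}$ be arbitrary edge costs (a 1,2-TSP instance). For $S \subseteq V$ let $\delta(S)$ be the set of edges with exactly one endpoint in $S$, and write $\delta(i)=\delta(\{i\})$. A tour is a Hamiltonian cycle of the complete graph; its cost is the sum of the costs of its edges. Let $OPT(c)$ be the minimum cost of a tour, and let $SUBT(c)$ be the optimal value of the subtour LP $$\min \sum_{e\in E} c(e)x(e)\quad\text{subject to}\quad \sum_{e\in\delta(i)}x(e)=2\ (i\in V),\qquad \sum_{e\in\delta(S)}x(e)\ge 2\ (S\subset V,\ 3\le |S|\le n-3),\qquad 0\le x(e)\le 1\ (e\in E).$$ Then both minima are attained, and $$OPT(c)\ \le\ \frac{19}{15}\,SUBT(c).$$ That is, the integrality gap of the subtour LP is at most $\frac{19}{15}$ for the 1,2-TSP. -/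

import Mathlib

namespace OneTwoTSP

variable {V : Type*} [Fintype V] [DecidableEq V]

/-- The edge set of the complete undirected graph on the set of cities `V`. -/
abbrev edges (V : Type*) [Fintype V] [DecidableEq V] : Finset (Sym2 V) :=
  (⊤ : SimpleGraph V).edgeFinset

/-- `cut S` is the set `δ(S)` of all edges with exactly one endpoint in `S`. -/
def cut (S : Finset V) : Finset (Sym2 V) :=
  (edges V).filter fun e => ∃ i ∈ S, ∃ j ∉ S, e = s(i, j)

/-- The cost of a closed walk in the complete graph: the sum of its edge costs. -/
def walkCost (c : Sym2 V → ℝ) {v : V} (p : (⊤ : SimpleGraph V).Walk v v) : ℝ :=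
  (p.edges.map c).sum

/-- The costs of all tours; a tour is a Hamiltonian cycle of the complete graph. -/
def tourCosts (c : Sym2 V → ℝ) : Set ℝ :=
  {t | ∃ (v : V) (p : (⊤ : SimpleGraph V).Walk v v), p.IsHamiltonianCycle ∧ walkCost c p = t}

/-- Feasibility for the subtour LP.  Only the values of `x` on edges matter: the values on the
diagonal of `Sym2 V` are not constrained and do not enter the objective. -/
structure IsSubtourFeasible (x : Sym2 V → ℝ) : Prop where
  degree : ∀ i : V, ∑ e ∈ cut {i}, x e = 2
  subtour : ∀ S : Finset V, 3 ≤ S.card → S.card + 3 ≤ Fintype.card V → 2 ≤ ∑ e ∈ cut S, x e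
  bounds : ∀ e ∈ edges V, 0 ≤ x e ∧ x e ≤ 1

/-- The objective function of the subtour LP. -/
def lpCost (c x : Sym2 V → ℝ) : ℝ := ∑ e ∈ edges V, c e * x e

/-- The objective values of all feasible solutions of the subtour LP. -/
def lpValues (c : Sym2 V → ℝ) : Set ℝ :=
  {t | ∃ x : Sym2 V → ℝ, IsSubtourFeasible x ∧ lpCost c x = t}

/-- The cost of an optimal tour. -/
noncomputable def optTour (c : Sym2 V → ℝ) : ℝ := sInf (tourCosts c)

/-- The optimal value of the subtour LP. -/
noncomputable def optSubtour (c : Sym2 V → ℝ) : ℝ := sInf (lpValues c)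

end OneTwoTSP

/-! Let `G` be the graph of cost-one edges on n cities, let `x` be an optimal LP solution, and let t
be the LP value minus n, which is the weight that `x` puts on cost-two edges. An ordering of the
cities with β non-adjacent consecutive pairs closes up to a tour of cost at most n + β + 1. So it
suffices to find one with β + 1 ≤ (4n + 19t)/15 (`IsFracTour.exists_list_breaks_le`).

Add T = ⌊t⌋ universal vertices to `G`. The cut constraints make the result tough: deleting S leaves
at most max(1, |S|) components (`IsFracTour.card_le_of_separates`). Tutte's theorem then gives a
perfect matching or, if n + T is odd, a matching that misses one prescribed vertex. The matching
edges, and the missed vertex, are short paths. A second matching, between path ends, joins every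
path to another one. It also comes from Tutte's theorem, through the gadget `slotGraph`, provided
that |A| ≤ 2|N(A)| + 1 for every set A of path ends. This holds because each end sends weight at
least 1 out of its path, while each vertex absorbs only weight 2 (`IsFracTour.card_le_ports`).

Every chain now consists of at least two paths, so for n + T even there are at most (n + T)/4
chains. Deleting the universal vertices costs at most T further breaks, which yields even 5/4 of the
LP value. For n + T odd and T > 0 the missed vertex is chosen universal; in the critical case it can
be listed first, where its deletion is free. The loss occurs when T = 0 and n is odd. Then there are
at most (n + 1)/4 chains, which is at most 4n/15 exactly when n ≥ 15; n = 15 is the source of 19/15.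
If n ≡ 1 mod 4, rounding removes the loss. For n = 7 and n = 11, either t is large enough to pay, or
the missed vertex is absorbed into a path on three vertices (`IsFracTour.exists_list_odd'`). -/

namespace OneTwoTSP

/-! ### Tutte's theorem in terms of component counts -/

/-- `𝒞` is a family of disjoint nonempty vertex sets, each of which is a union of components
of `G - S`. -/
structure Separates {W : Type*} (G : SimpleGraph W) (S : Finset W) (𝒞 : Finset (Finset W)) :
    Prop where
  nonempty : ∀ C ∈ 𝒞, C.Nonempty
  notMem : ∀ C ∈ 𝒞, ∀ a ∈ C, a ∉ S
  closed : ∀ C ∈ 𝒞, ∀ a ∈ C, ∀ b, G.Adj a b → b ∈ C ∨ b ∈ S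
  disjoint : ∀ C ∈ 𝒞, ∀ D ∈ 𝒞, ∀ a, a ∈ C → a ∈ D → C = D

/-- A form of Tutte's theorem: a perfect matching exists if no removal of a set `S` leaves more
than `|S| + 1` components. -/
theorem exists_perfectMatching {W : Type*} [Fintype W] [DecidableEq W] (G : SimpleGraph W)
    (heven : Even (Fintype.card W))
    (h : ∀ S 𝒞, Separates G S 𝒞 → 𝒞.card ≤ S.card + 1) :
    ∃ σ : W → W, ∀ w, G.Adj w (σ w) ∧ σ (σ w) = w := by
  classical
  have key : ∃ M : G.Subgraph, M.IsPerfectMatching := by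
    rw [SimpleGraph.tutte]
    intro u hu
    unfold SimpleGraph.IsTutteViolator at hu
    set H := ((⊤ : G.Subgraph).deleteVerts u).coe with hH
    have hodd := SimpleGraph.odd_ncard_oddComponents H
    have hcardV : Nat.card ((⊤ : G.Subgraph).deleteVerts u).verts + u.ncard
        = Fintype.card W := by
      rw [Nat.card_coe_set_eq]
      have : ((⊤ : G.Subgraph).deleteVerts u).verts = uᶜ := by
        ext; simp
      rw [this, add_comm, Set.ncard_add_ncard_compl, Nat.card_eq_fintype_card]
    let f : H.ConnectedComponent → Finset W := fun c => (Subtype.val '' c.supp).toFinset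
    have hf : Function.Injective f := by
      intro c d hcd
      obtain ⟨a, ha⟩ := c.nonempty_supp
      have : (a : W) ∈ f c := by simp only [f, Set.mem_toFinset]; exact ⟨a, ha, rfl⟩
      rw [hcd] at this
      simp only [f, Set.mem_toFinset] at this
      obtain ⟨b, hb, hab⟩ := this
      have hba : b = a := Subtype.ext hab
      subst hba
      rw [← (SimpleGraph.ConnectedComponent.mem_supp_iff _ _).mp ha,
        ← (SimpleGraph.ConnectedComponent.mem_supp_iff _ _).mp hb]
    have hle := h u.toFinset (H.oddComponents.toFinset.image f) ?_
    · rw [Finset.card_image_of_injective _ hf, ← Set.ncard_eq_toFinset_card',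
        ← Set.ncard_eq_toFinset_card'] at hle
      -- A Tutte violator has more than |u| odd components, so exactly |u| + 1 are left. The number
      -- of odd components has the parity of |W| - |u|, hence of |u|, which is a contradiction.
      have h2 : H.oddComponents.ncard = u.ncard + 1 := by omega
      rw [h2] at hodd
      rcases Nat.even_or_odd u.ncard with he | ho
      · have := hodd.1 he.add_one
        rw [← hcardV] at heven
        exact Nat.not_even_iff_odd.2 (this.add_even he) heven
      · have h3 : ¬ Odd (Nat.card ((⊤ : G.Subgraph).deleteVerts u).verts) := fun h4 =>
          Nat.not_even_iff_odd.2 (hodd.2 h4) ho.add_one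
        rw [← hcardV] at heven
        exact Nat.not_even_iff_odd.2 ((Nat.not_odd_iff_even.1 h3).add_odd ho) heven
    · constructor
      · intro C hC
        simp only [Finset.mem_image] at hC
        obtain ⟨c, -, rfl⟩ := hC
        obtain ⟨a, ha⟩ := c.nonempty_supp
        exact ⟨a, by simp only [f, Set.mem_toFinset]; exact ⟨a, ha, rfl⟩⟩
      · intro C hC a ha
        simp only [Finset.mem_image] at hC
        obtain ⟨c, -, rfl⟩ := hC
        simp only [f, Set.mem_toFinset] at ha
        obtain ⟨b, hb, rfl⟩ := ha
        have := b.2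
        simp at this
        simpa using this
      · intro C hC a ha b hab
        simp only [Finset.mem_image] at hC
        obtain ⟨c, -, rfl⟩ := hC
        simp only [f, Set.mem_toFinset] at ha ⊢
        obtain ⟨a, ha, rfl⟩ := ha
        by_cases hb : b ∈ u
        · exact Or.inr hb
        · left
          refine ⟨⟨b, by simpa using hb⟩, ?_, rfl⟩
          refine SimpleGraph.ConnectedComponent.mem_supp_of_adj_mem_supp c ha ?_
          have ha2 := a.2
          simp at ha2
          simp [hH, SimpleGraph.Subgraph.coe_adj, ha2, hb, hab]
      · intro C hC D hD a haC haD
        simp only [Finset.mem_image] at hC hD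
        obtain ⟨c, -, rfl⟩ := hC
        obtain ⟨d, -, rfl⟩ := hD
        simp only [f, Set.mem_toFinset] at haC haD
        obtain ⟨a, ha, rfl⟩ := haC
        obtain ⟨b, hb, hab⟩ := haD
        have hba : b = a := Subtype.ext hab
        subst hba
        rw [← (SimpleGraph.ConnectedComponent.mem_supp_iff _ _).mp ha,
          ← (SimpleGraph.ConnectedComponent.mem_supp_iff _ _).mp hb]
  obtain ⟨M, hM⟩ := key
  choose σ hσ hσ' using fun w => hM.1 (hM.2 w)
  refine ⟨σ, fun w => ⟨M.adj_sub (hσ w), ?_⟩⟩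
  exact (hσ' (σ w) w (hσ w).symm).symm

/-! ### Linking the pieces by a matching of their slots -/

/-- The graph on slots and auxiliary vertices whose perfect matchings correspond to matchings of `H`
meeting every piece: every slot of piece `i` is joined to the auxiliary vertex of `i`, and the
auxiliary vertices form a clique, padded by `k` vertices. -/
def slotGraph {I : Type*} (H : SimpleGraph (I × Bool)) (k : ℕ) :
    SimpleGraph ((I × Bool) ⊕ (I ⊕ Fin k)) where
  Adj
    | .inl s, .inl s' => H.Adj s s'
    | .inl s, .inr (.inl i) => s.1 = i
    | .inr (.inl i), .inl s => s.1 = i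
    | .inr z, .inr z' => z ≠ z'
    | _, _ => False
  symm := ⟨by
    rintro (s | (i | j)) (s' | (i' | j')) h
    · exact H.symm.symm _ _ h
    all_goals first | exact h | exact h.symm⟩
  loopless := ⟨by
    rintro (s | (i | j)) h
    · exact H.loopless.irrefl _ h
    all_goals exact h rfl⟩

lemma slotGraph_adj_inr {I : Type*} (H : SimpleGraph (I × Bool)) {k : ℕ} {z z' : I ⊕ Fin k}
    (h : z ≠ z') : (slotGraph H k).Adj (.inr z) (.inr z') := by
  rcases z with i | j <;> rcases z' with i' | j' <;> exact h

/-- The auxiliary vertices form a clique, so at most one member of `𝒞` contains any of them. Let `𝒟`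
be the rest, which consist of slots only. Every slot in a member of `𝒟` has its auxiliary vertex in
`S`, and each auxiliary vertex serves two slots. A singleton member of `𝒟` has all its
`H`-neighbours in `S`, so the hypothesis bounds the number of singletons. Since 2 ≤ |C| + [|C| = 1]
for each member, adding the two bounds gives 2|𝒟| ≤ 2|S| + 1, hence |𝒟| ≤ |S|. -/
lemma card_le_of_separates_slotGraph {I : Type*} [Fintype I] [DecidableEq I]
    (H : SimpleGraph (I × Bool)) [DecidableRel H.Adj] (k : ℕ)
    (hH : ∀ A : Finset (I × Bool),
      A.card ≤ 2 * (Finset.univ.filter fun s => ∃ a ∈ A, H.Adj a s).card + 1)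
    (S : Finset ((I × Bool) ⊕ (I ⊕ Fin k))) (𝒞 : Finset (Finset ((I × Bool) ⊕ (I ⊕ Fin k))))
    (h : Separates (slotGraph H k) S 𝒞) : 𝒞.card ≤ S.card + 1 := by
  classical
  set 𝒟 := 𝒞.filter fun C => ∀ z, Sum.inr z ∉ C with h𝒟
  have h1 : (𝒞.filter fun C => ¬ ∀ z, Sum.inr z ∉ C).card ≤ 1 := by
    rw [Finset.card_le_one]
    intro C hC D hD
    simp only [Finset.mem_filter, not_forall, not_not] at hC hD
    obtain ⟨hC, z, hz⟩ := hC
    obtain ⟨hD, z', hz'⟩ := hD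
    by_cases hzz : z = z'
    · subst hzz
      exact h.disjoint C hC D hD _ hz hz'
    · have : (slotGraph H k).Adj (Sum.inr z) (Sum.inr z') :=
        slotGraph_adj_inr H hzz
      rcases h.closed C hC _ hz _ this with h3 | h3
      · exact h.disjoint C hC D hD _ h3 hz'
      · exact absurd h3 (h.notMem D hD _ hz')
  have hsplit : 𝒟.card + (𝒞.filter fun C => ¬ ∀ z, Sum.inr z ∉ C).card = 𝒞.card :=
    Finset.card_filter_add_card_filter_not _
  suffices hD : 2 * 𝒟.card ≤ 2 * S.card + 1 by omega
  set U : Finset (I × Bool) := Finset.univ.filter fun s => ∃ C ∈ 𝒟, Sum.inl s ∈ C with hU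
  set A : Finset (I × Bool) := Finset.univ.filter fun s => {Sum.inl s} ∈ 𝒟 with hA
  set SZ : Finset I := Finset.univ.filter fun i => Sum.inr (Sum.inl i) ∈ S with hSZ
  set SH : Finset (I × Bool) := Finset.univ.filter fun s => Sum.inl s ∈ S with hSH
  have hUZ : U.card ≤ 2 * SZ.card := by
    have : U ⊆ SZ ×ˢ (Finset.univ : Finset Bool) := by
      intro s hs
      simp only [hU, Finset.mem_filter, Finset.mem_univ, true_and, h𝒟] at hs
      obtain ⟨C, ⟨hC, hz⟩, hsC⟩ := hs
      have : (slotGraph H k).Adj (Sum.inl s) (Sum.inr (Sum.inl s.1)) := rfl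
      rcases h.closed C hC _ hsC _ this with h3 | h3
      · exact absurd h3 (hz _)
      · simp [hSZ, h3]
    have := Finset.card_le_card this
    rw [Finset.card_product] at this
    simpa [mul_comm] using this
  have hAN : A.card ≤ 2 * SH.card + 1 := by
    refine (hH A).trans ?_
    have : (Finset.univ.filter fun s => ∃ a ∈ A, H.Adj a s) ⊆ SH := by
      intro s hs
      simp only [hA, Finset.mem_filter, Finset.mem_univ, true_and] at hs
      obtain ⟨a, ha, has⟩ := hs
      have h3 : (slotGraph H k).Adj (Sum.inl a) (Sum.inl s) := has
      rcases h.closed _ (Finset.mem_filter.1 ha).1 _ (Finset.mem_singleton_self _) _ h3 with h4 | h4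
      · simp only [Finset.mem_singleton, Sum.inl.injEq] at h4
        exact absurd h4.symm has.ne
      · simpa [hSH] using h4
    have := Finset.card_le_card this
    omega
  have hS : SZ.card + SH.card ≤ S.card := by
    have h3 : SZ.map ⟨fun i => Sum.inr (Sum.inl i), fun a b hab => by simpa using hab⟩ ∪
        SH.map ⟨Sum.inl, Sum.inl_injective⟩ ⊆ S := by
      intro x hx
      simp only [Finset.mem_union, Finset.mem_map, hSZ, hSH, Finset.mem_filter, Finset.mem_univ,
        true_and, Function.Embedding.coeFn_mk] at hx
      rcases hx with ⟨i, hi, rfl⟩ | ⟨s, hs, rfl⟩ <;> assumption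
    have := Finset.card_le_card h3
    rwa [Finset.card_union_of_disjoint, Finset.card_map, Finset.card_map] at this
    rw [Finset.disjoint_left]
    intro x hx hx'
    simp only [Finset.mem_map, Function.Embedding.coeFn_mk] at hx hx'
    obtain ⟨i, -, rfl⟩ := hx
    obtain ⟨s, -, h⟩ := hx'
    cases h
  have hsum : ∑ C ∈ 𝒟, C.card = U.card := by
    rw [← Finset.card_biUnion (t := fun C => C)]
    · rw [← Finset.card_map (s := U) ⟨Sum.inl, Sum.inl_injective⟩]
      apply congrArg Finset.card
      ext x
      simp only [Finset.mem_biUnion, Finset.mem_map, hU, Finset.mem_filter, Finset.mem_univ,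
        true_and, Function.Embedding.coeFn_mk]
      constructor
      · rintro ⟨C, hC, hx⟩
        rcases x with s | z
        · exact ⟨s, ⟨C, hC, hx⟩, rfl⟩
        · exact absurd hx ((Finset.mem_filter.1 hC).2 z)
      · rintro ⟨s, ⟨C, hC, hs⟩, rfl⟩
        exact ⟨C, hC, hs⟩
    · intro C hC D hD hne
      refine Finset.disjoint_left.2 fun a ha hb => ?_
      exact hne (h.disjoint C (Finset.mem_filter.1 hC).1 D (Finset.mem_filter.1 hD).1 a ha hb)
  have hone : (𝒟.filter fun C => C.card = 1).card ≤ A.card := by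
    rw [← Finset.card_image_of_injective (f := fun s : I × Bool =>
      ({Sum.inl s} : Finset ((I × Bool) ⊕ (I ⊕ Fin k)))) A (fun a b hab => by simpa using hab)]
    apply Finset.card_le_card
    intro C hC
    simp only [Finset.mem_filter] at hC
    obtain ⟨a, rfl⟩ := Finset.card_eq_one.1 hC.2
    rcases a with s | z
    · exact Finset.mem_image.2 ⟨s, by simpa [hA] using hC.1, rfl⟩
    · exact absurd (Finset.mem_singleton_self _) ((Finset.mem_filter.1 hC.1).2 z)
  have htwo : 2 * 𝒟.card ≤ ∑ C ∈ 𝒟, (C.card + if C.card = 1 then 1 else 0) := by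
    rw [mul_comm, ← smul_eq_mul]
    apply Finset.card_nsmul_le_sum
    intro C hC
    have := (h.nonempty C (Finset.mem_filter.1 hC).1).card_pos
    split_ifs <;> omega
  rw [Finset.sum_add_distrib, hsum, ← Finset.card_filter] at htwo
  omega

/-- If every set `A` of slots satisfies `|A| ≤ 2 |N(A)| + 1`, then some matching meets every piece. -/
theorem exists_linking {I : Type*} [Fintype I] [DecidableEq I]
    (H : SimpleGraph (I × Bool)) [DecidableRel H.Adj]
    (hH : ∀ A : Finset (I × Bool),
      A.card ≤ 2 * (Finset.univ.filter fun s => ∃ a ∈ A, H.Adj a s).card + 1) :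
    ∃ σ : I × Bool → Option (I × Bool),
      (∀ s s', σ s = some s' → H.Adj s s' ∧ σ s' = some s) ∧ ∀ i, ∃ b s, σ (i, b) = some s := by
  classical
  -- There are 3|I| slots and auxiliary vertices; the padding makes their number even.
  obtain ⟨τ, hτ⟩ := exists_perfectMatching (slotGraph H (Fintype.card I % 2))
    (by
      simp only [Fintype.card_sum, Fintype.card_prod, Fintype.card_bool, Fintype.card_fin]
      rw [Nat.even_iff]
      omega)
    (card_le_of_separates_slotGraph H _ hH)
  refine ⟨fun s => (τ (Sum.inl s)).getLeft?, ?_, ?_⟩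
  · intro s s' hs
    simp only [Sum.getLeft?_eq_some_iff] at hs ⊢
    have := hτ (Sum.inl s)
    rw [hs] at this
    exact this
  · intro i
    -- Otherwise both slots of `i` would be matched to the single auxiliary vertex of `i`.
    by_contra hcon
    push Not at hcon
    have key : ∀ b, τ (Sum.inl (i, b)) = Sum.inr (Sum.inl i) := by
      intro b
      have h1 := (hτ (Sum.inl (i, b))).1
      rcases h2 : τ (Sum.inl (i, b)) with s | (j | j)
      · exact absurd (by simp [h2]) (hcon b s)
      · rw [h2] at h1
        have : i = j := h1
        rw [this]
      · rw [h2] at h1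
        exact absurd h1 id
    have h1 := (hτ (Sum.inl (i, true))).2
    have h2 := (hτ (Sum.inl (i, false))).2
    rw [key] at h1 h2
    rw [h1] at h2
    simp at h2

/-- A matching of slots that meets every piece splits the pieces into oriented chains of at least
two pieces each. -/
theorem exists_chains {I : Type*} [Fintype I] [DecidableEq I]
    (σ : I × Bool → Option (I × Bool))
    (hσ : ∀ s s', σ s = some s' → s.1 ≠ s'.1 ∧ σ s' = some s)
    (hmeet : ∀ i, ∃ b s, σ (i, b) = some s) :
    ∃ 𝓛 : List (List (I × Bool)),
      (∀ c ∈ 𝓛, 2 ≤ c.length ∧ c.IsChain fun o o' => σ (o.1, !o.2) = some o') ∧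
      (𝓛.flatten.map Prod.fst).Nodup ∧ ∀ i, i ∈ 𝓛.flatten.map Prod.fst := by
  classical
  -- An oriented piece `o` is entered at the slot `o` and left at the opposite slot; `R` says that
  -- the exit is matched to the next entrance.
  set R : I × Bool → I × Bool → Prop := fun o o' => σ (o.1, !o.2) = some o' with hR
  -- Take a partition into the fewest nonempty chains. A chain of one piece `i` could be merged with
  -- the chain of a piece linked to `i`.
  let P : ℕ → Prop := fun n => ∃ 𝓛 : List (List (I × Bool)), 𝓛.length = n ∧
      (∀ c ∈ 𝓛, c ≠ [] ∧ c.IsChain R) ∧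
      (𝓛.flatten.map Prod.fst).Nodup ∧ ∀ i, i ∈ 𝓛.flatten.map Prod.fst
  have hP : ∃ n, P n := by
    refine ⟨_, (Finset.univ : Finset I).toList.map (fun i => [(i, true)]), rfl, ?_, ?_, ?_⟩
    · intro c hc
      simp only [List.mem_map] at hc
      obtain ⟨i, -, rfl⟩ := hc
      simp
    · have : (((Finset.univ : Finset I).toList.map (fun i => [(i, true)])).flatten.map Prod.fst)
          = (Finset.univ : Finset I).toList := by
        simp [← List.flatMap_def, List.map_flatMap]
      rw [this]
      exact Finset.nodup_toList _
    · intro i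
      simp
  obtain ⟨𝓛, hlen, hch, hnd, hall⟩ := Nat.find_spec hP
  have hmin : ∀ 𝓛' : List (List (I × Bool)), 𝓛'.length < 𝓛.length →
      (∀ c ∈ 𝓛', c ≠ [] ∧ c.IsChain R) → (𝓛'.flatten.map Prod.fst).Nodup →
      ¬ ∀ i, i ∈ 𝓛'.flatten.map Prod.fst := by
    intro 𝓛' h1 h2 h3 h4
    rw [hlen] at h1
    exact Nat.find_min hP h1 ⟨𝓛', rfl, h2, h3, h4⟩
  refine ⟨𝓛, fun c hc => ⟨?_, (hch c hc).2⟩, hnd, hall⟩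
  by_contra hlt
  obtain ⟨⟨i, b0⟩, rfl⟩ : ∃ o, c = [o] := by
    rw [← List.length_eq_one_iff]
    have := List.length_pos_iff.2 (hch c hc).1
    omega
  obtain ⟨b, ⟨j, d⟩, hbj⟩ := hmeet i
  obtain ⟨hij, hjb⟩ := hσ _ _ hbj
  simp only at hij
  obtain ⟨c', hc', hjc'⟩ : ∃ c' ∈ 𝓛, ∃ e, (j, e) ∈ c' := by
    have := hall j
    simp only [List.mem_map, List.mem_flatten] at this
    obtain ⟨⟨j', e⟩, ⟨c', hc', hm⟩, rfl⟩ := this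
    exact ⟨c', hc', e, hm⟩
  obtain ⟨e, he⟩ := hjc'
  have hne : c' ≠ [(i, b0)] := by
    rintro rfl
    simp at he
    exact hij he.1.symm
  have hp1 := List.perm_cons_erase hc
  have hp2 := List.perm_cons_erase ((List.mem_erase_of_ne hne).2 hc')
  have hp := hp1.trans (hp2.cons [(i, b0)])
  set rest := (𝓛.erase [(i, b0)]).erase c'
  have hpf := (hp.flatten).map Prod.fst
  simp only [List.flatten_cons, List.map_append, List.map_cons,
    List.singleton_append] at hpf
  have hnd' := hpf.nodup_iff.1 hnd
  have hi : ∀ e, (i, e) ∉ c' := by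
    intro e hie
    rw [List.nodup_cons] at hnd'
    apply hnd'.1
    simp only [List.mem_append]
    exact Or.inl (List.mem_map.2 ⟨(i, e), hie, rfl⟩)
  have hrest : ∀ c ∈ rest, c ≠ [] ∧ c.IsChain R := fun c hc =>
    hch c (hp.mem_iff.2 (by simp [hc]))
  have hlenp := hp.length_eq
  simp only [List.length_cons] at hlenp
  have finish : ∀ m : List (I × Bool), m ≠ [] → m.IsChain R →
      (m.map Prod.fst).Perm (i :: c'.map Prod.fst) → False := by
    intro m hm0 hm hmp
    have hperm : (((m :: rest).flatten).map Prod.fst).Perm (𝓛.flatten.map Prod.fst) := by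
      refine List.Perm.trans ?_ hpf.symm
      simp only [List.flatten_cons, List.map_append]
      exact hmp.append_right _
    refine hmin (m :: rest) (by simp only [List.length_cons]; omega) ?_ (hperm.nodup_iff.2 hnd)
      (fun i => hperm.mem_iff.2 (hall i))
    intro c hc
    rcases List.mem_cons.1 hc with rfl | hc
    · exact ⟨hm0, hm⟩
    · exact hrest c hc
  obtain ⟨p, q, rfl⟩ := List.append_of_mem he
  have hchain := (hch _ hc').2
  -- The slot `(j, d)` linked to `i` is either the entrance or the exit of `j` in its chain. At the
  -- corresponding end of the chain, `i` can be attached. Elsewhere that slot is already matched to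
  -- a neighbour within the chain, which would have to be `i`.
  by_cases hed : e = d
  · subst hed
    rcases List.eq_nil_or_concat p with rfl | ⟨p', o, rfl⟩
    · refine finish ((i, !b) :: ((j, e) :: q)) (by simp) ?_ (by simp)
      rw [List.isChain_cons_cons]
      exact ⟨by simpa [hR] using hbj, by simpa using hchain⟩
    · have hRo : R o (j, e) := by
        have h3 : (p'.concat o ++ (j, e) :: q) = p' ++ ([o, (j, e)] ++ q) := by simp
        rw [h3] at hchain
        have h4 := hchain.right_of_append.left_of_append
        simpa using h4
      have h5 := (hσ _ _ hRo).2
      rw [hjb] at h5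
      simp only [Option.some.injEq, Prod.mk.injEq] at h5
      apply hi o.2
      rw [h5.1]
      simp
  · have hed' : e = !d := by
      cases e <;> cases d <;> simp_all
    subst hed'
    rcases q with _ | ⟨o, q⟩
    · refine finish ((p ++ [(j, !d)]) ++ [(i, b)]) (by simp) ?_ ?_
      · rw [List.isChain_append]
        refine ⟨hchain, by simp, ?_⟩
        intro x hx y hy
        simp at hx hy
        subst hx hy
        simpa [hR] using hjb
      · simp only [List.map_append, List.map_cons, List.map_nil]
        exact List.perm_append_singleton _ _
    · have hRo : R (j, !d) o := by
        have h3 : (p ++ (j, !d) :: o :: q) = p ++ ([(j, !d), o] ++ q) := by simp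
        rw [h3] at hchain
        have h4 := hchain.right_of_append.left_of_append
        simpa using h4
      simp only [hR, Bool.not_not] at hRo
      rw [hjb] at hRo
      simp only [Option.some.injEq] at hRo
      apply hi b
      rw [hRo]
      simp

/-! ### Fractional tours and toughness -/

open Classical in
/-- A fractional tour with edge weights `w`, whose total weight on pairs not adjacent in `G`
is `t`. -/
structure IsFracTour {V : Type*} [Fintype V] [DecidableEq V] (G : SimpleGraph V)
    (w : V → V → ℝ) (t : ℝ) : Prop where
  symm : ∀ u v, w u v = w v u
  nonneg : ∀ u v, 0 ≤ w u v
  le_one : ∀ u v, w u v ≤ 1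
  self : ∀ u, w u u = 0
  degree : ∀ u, ∑ v, w u v = 2
  cut : ∀ S : Finset V, S.Nonempty → S ≠ Finset.univ → 2 ≤ ∑ u ∈ S, ∑ v ∈ Sᶜ, w u v
  slack : ∑ u, ∑ v, (if G.Adj u v then 0 else w u v) = 2 * t

/-- The graph `G` with `T` additional vertices, each adjacent to all other vertices. -/
def addUniversal {V : Type*} (G : SimpleGraph V) (T : ℕ) : SimpleGraph (V ⊕ Fin T) where
  Adj x y := x ≠ y ∧ ∀ u v, x = .inl u → y = .inl v → G.Adj u v
  symm := ⟨fun _ _ h => ⟨h.1.symm, fun u v hu hv => (h.2 v u hv hu).symm⟩⟩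
  loopless := ⟨fun _ h => h.1 rfl⟩

lemma addUniversal_adj_inl {V : Type*} {G : SimpleGraph V} {T : ℕ} {u v : V} :
    (addUniversal G T).Adj (.inl u) (.inl v) ↔ G.Adj u v := by
  constructor
  · intro h
    exact h.2 u v rfl rfl
  · intro h
    refine ⟨by simpa using h.ne, ?_⟩
    intro u' v' hu hv
    cases hu
    cases hv
    exact h

lemma addUniversal_adj_inr {V : Type*} {G : SimpleGraph V} {T : ℕ} {x : V ⊕ Fin T} {d : Fin T}
    (h : x ≠ .inr d) : (addUniversal G T).Adj x (.inr d) :=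
  ⟨h, fun _ _ _ hv => by cases hv⟩

/-- Fractional tours make the graph tough. -/
lemma IsFracTour.card_le_of_separates {V : Type*} [Fintype V] [DecidableEq V] {G : SimpleGraph V}
    {w : V → V → ℝ} {t : ℝ} (h : IsFracTour G w t) {T : ℕ} (ht : t < T + 1)
    {S : Finset (V ⊕ Fin T)} {𝒞 : Finset (Finset (V ⊕ Fin T))}
    (hS : Separates (addUniversal G T) S 𝒞) : 𝒞.card ≤ max 1 S.card := by
  classical
  by_cases hd : ∃ d, Sum.inr d ∉ S
  · obtain ⟨d, hd⟩ := hd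
    refine le_max_of_le_left (Finset.card_le_one.2 ?_)
    have key : ∀ C ∈ 𝒞, Sum.inr d ∈ C := by
      intro C hC
      obtain ⟨a, ha⟩ := hS.nonempty C hC
      by_cases had : a = Sum.inr d
      · exact had ▸ ha
      · exact (hS.closed C hC a ha _ (addUniversal_adj_inr had)).resolve_right hd
    exact fun C hC D hD => hS.disjoint C hC D hD _ (key C hC) (key D hD)
  push Not at hd
  rcases Nat.lt_or_ge 1 𝒞.card with h1 | h1
  swap
  · exact le_max_of_le_left h1
  refine le_max_of_le_right ?_
  set S0 : Finset V := Finset.univ.filter fun v => Sum.inl v ∈ S with hS0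
  let f : Finset (V ⊕ Fin T) → Finset V := fun C => Finset.univ.filter fun v => Sum.inl v ∈ C
  have hf : ∀ C v, v ∈ f C ↔ Sum.inl v ∈ C := by simp [f]
  have hne : ∀ C ∈ 𝒞, (f C).Nonempty := by
    intro C hC
    obtain ⟨a, ha⟩ := hS.nonempty C hC
    rcases a with v | d
    · exact ⟨v, by simpa [f] using ha⟩
    · exact absurd (hd d) (hS.notMem C hC _ ha)
  have hnu : ∀ C ∈ 𝒞, f C ≠ Finset.univ := by
    intro C hC hCu
    obtain ⟨D, hD, hDC⟩ := Finset.exists_mem_ne h1 C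
    obtain ⟨v, hv⟩ := hne D hD
    have : v ∈ f C := hCu ▸ Finset.mem_univ v
    exact hDC (hS.disjoint D hD C hC _ ((hf _ _).1 hv) ((hf _ _).1 this))
  -- The weight leaving `C` goes to non-neighbours or into `S0`, so it is at most the sum of `g`
  -- over `C`. Over all vertices `g` sums to 2t + 2|S0|, whereas each of the disjoint sets needs 2.
  let g : V → ℝ := fun u =>
    ∑ v, ((if G.Adj u v then 0 else w u v) + if v ∈ S0 then w u v else 0)
  have hna : ∀ u v, 0 ≤ if G.Adj u v then 0 else w u v := by
    intro u v
    split_ifs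
    · exact le_rfl
    · exact h.nonneg _ _
  have hg0 : ∀ u, 0 ≤ g u := by
    intro u
    refine Finset.sum_nonneg fun v _ => add_nonneg (hna u v) ?_
    split_ifs
    · exact h.nonneg _ _
    · exact le_rfl
  have hC : ∀ C ∈ 𝒞, 2 ≤ ∑ u ∈ f C, g u := by
    intro C hC
    refine (h.cut _ (hne C hC) (hnu C hC)).trans (Finset.sum_le_sum fun u hu => ?_)
    have hcompl : ∑ v ∈ (f C)ᶜ, w u v = ∑ v, if v ∈ f C then 0 else w u v := by
      rw [Finset.compl_eq_univ_sdiff, Finset.sdiff_eq_filter, Finset.sum_filter]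
      exact Finset.sum_congr rfl fun v _ => by split_ifs <;> simp_all
    rw [hcompl]
    refine Finset.sum_le_sum fun v _ => ?_
    · by_cases hvC : v ∈ f C
      · rw [if_pos hvC]
        refine add_nonneg (hna u v) ?_
        split_ifs
        · exact h.nonneg _ _
        · exact le_rfl
      · rw [if_neg hvC]
        by_cases hadj : G.Adj u v
        · have := hS.closed C hC _ ((hf _ _).1 hu) (Sum.inl v) (addUniversal_adj_inl.2 hadj)
          have hv : v ∈ S0 := by
            simpa [hS0] using this.resolve_left (fun h => hvC ((hf _ _).2 h))
          simp [hadj, hv]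
        · rw [if_neg hadj]
          have : (0 : ℝ) ≤ if v ∈ S0 then w u v else 0 := by
            split_ifs
            · exact h.nonneg _ _
            · exact le_rfl
          linarith
  have hsum : (2 : ℝ) * 𝒞.card ≤ ∑ u, g u := by
    have h2 : ∑ C ∈ 𝒞, (2 : ℝ) ≤ ∑ C ∈ 𝒞, ∑ u ∈ f C, g u := Finset.sum_le_sum hC
    rw [Finset.sum_const, nsmul_eq_mul, mul_comm] at h2
    refine h2.trans ?_
    rw [← Finset.sum_biUnion]
    · exact Finset.sum_le_sum_of_subset_of_nonneg (Finset.subset_univ _) fun u _ _ => hg0 u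
    · intro C hC D hD hCD
      refine Finset.disjoint_left.2 fun v hv hv' => hCD ?_
      exact hS.disjoint C hC D hD _ ((hf _ _).1 hv) ((hf _ _).1 hv')
  have hgsum : ∑ u, g u = 2 * t + 2 * S0.card := by
    simp only [g, Finset.sum_add_distrib]
    rw [h.slack]
    congr 1
    rw [Finset.sum_comm]
    have : ∀ v ∈ (Finset.univ : Finset V), (∑ u, if v ∈ S0 then w u v else 0)
        = if v ∈ S0 then 2 else 0 := by
      intro v _
      split_ifs
      · rw [← h.degree v]
        exact Finset.sum_congr rfl fun u _ => h.symm u v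
      · simp
    rw [Finset.sum_congr rfl this, ← Finset.sum_filter]
    simp [mul_comm]
  have hcard : S0.card + T ≤ S.card := by
    have : S0.map ⟨Sum.inl, Sum.inl_injective⟩ ∪
        (Finset.univ : Finset (Fin T)).map ⟨Sum.inr, Sum.inr_injective⟩ ⊆ S := by
      intro x hx
      simp only [Finset.mem_union, Finset.mem_map, hS0, Finset.mem_filter, Finset.mem_univ,
        true_and, Function.Embedding.coeFn_mk] at hx
      rcases hx with ⟨v, hv, rfl⟩ | ⟨d, rfl⟩
      · exact hv
      · exact hd d
    have h3 := Finset.card_le_card this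
    rwa [Finset.card_union_of_disjoint, Finset.card_map, Finset.card_map, Finset.card_univ,
      Fintype.card_fin] at h3
    rw [Finset.disjoint_left]
    intro x hx hx'
    simp only [Finset.mem_map, Function.Embedding.coeFn_mk] at hx hx'
    obtain ⟨i, -, rfl⟩ := hx
    obtain ⟨s, -, h⟩ := hx'
    cases h
  rw [hgsum] at hsum
  have h4 : (𝒞.card : ℝ) < (S0.card + T + 1 : ℕ) := by
    push_cast
    linarith
  have := Nat.cast_lt.1 h4
  omega

/-! ### Matchings that miss at most one vertex -/

/-- `σ` matches the vertices outside `X` along edges of `G`. -/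
def IsMatchingOff {W : Type*} (G : SimpleGraph W) (X : Finset W) (σ : W → W) : Prop :=
  ∀ u, u ∉ X → σ u ∉ X ∧ G.Adj u (σ u) ∧ σ (σ u) = u

lemma exists_isMatchingOff_empty {W : Type*} [Fintype W] [DecidableEq W] (G : SimpleGraph W)
    (heven : Even (Fintype.card W))
    (h : ∀ S 𝒞, Separates G S 𝒞 → 𝒞.card ≤ max 1 S.card) :
    ∃ σ, IsMatchingOff G ∅ σ := by
  obtain ⟨σ, hσ⟩ := exists_perfectMatching G heven
    (fun S 𝒞 hS => (h S 𝒞 hS).trans (max_le (by omega) (by omega)))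
  exact ⟨σ, fun u _ => ⟨by simp, hσ u⟩⟩

/-- Deleting `x` along with `S` raises the toughness bound to |S| + 1, which is exactly what
`exists_perfectMatching` tolerates. -/
lemma exists_isMatchingOff_singleton {W : Type*} [Fintype W] [DecidableEq W] (G : SimpleGraph W)
    (hodd : Odd (Fintype.card W))
    (h : ∀ S 𝒞, Separates G S 𝒞 → 𝒞.card ≤ max 1 S.card) (x : W) :
    ∃ σ, IsMatchingOff G {x} σ := by
  classical
  have hcard : Fintype.card {y // y ≠ x} = Fintype.card W - 1 := by
    simp [Fintype.card_subtype_compl]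
  obtain ⟨τ, hτ⟩ := exists_perfectMatching (G.comap (Subtype.val : {y // y ≠ x} → W))
    (by rw [hcard]; exact Nat.Odd.sub_odd hodd odd_one) (by
      intro S 𝒞 hS
      let ι : {y // y ≠ x} ↪ W := Function.Embedding.subtype _
      let F : Finset {y // y ≠ x} ↪ Finset W := ⟨fun C => C.map ι, Finset.map_injective ι⟩
      have key := h (insert x (S.map ι)) (𝒞.map F) ?_
      · rw [Finset.card_map, Finset.card_insert_of_notMem (by simp [ι]), Finset.card_map] at key
        exact key.trans (max_le (by omega) le_rfl)
      · constructor
        · intro C hC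
          obtain ⟨C, hC', rfl⟩ := Finset.mem_map.1 hC
          exact (hS.nonempty C hC').map
        · intro C hC a ha
          obtain ⟨C, hC', rfl⟩ := Finset.mem_map.1 hC
          obtain ⟨a, ha', rfl⟩ := Finset.mem_map.1 ha
          have := hS.notMem C hC' a ha'
          have := a.2
          simp_all [ι]
        · intro C hC a ha b hab
          obtain ⟨C, hC', rfl⟩ := Finset.mem_map.1 hC
          obtain ⟨a, ha', rfl⟩ := Finset.mem_map.1 ha
          by_cases hb : b = x
          · exact Or.inr (by simp [hb])
          · rcases hS.closed C hC' a ha' ⟨b, hb⟩ hab with h | h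
            · exact Or.inl (Finset.mem_map.2 ⟨_, h, rfl⟩)
            · exact Or.inr (Finset.mem_insert_of_mem (Finset.mem_map.2 ⟨_, h, rfl⟩))
        · intro C hC D hD a haC haD
          obtain ⟨C, hC', rfl⟩ := Finset.mem_map.1 hC
          obtain ⟨D, hD', rfl⟩ := Finset.mem_map.1 hD
          obtain ⟨a, haC', rfl⟩ := Finset.mem_map.1 haC
          obtain ⟨b, haD', hab⟩ := Finset.mem_map.1 haD
          rw [ι.injective hab] at haD'
          rw [hS.disjoint C hC' D hD' a haC' haD'])
  refine ⟨fun y => if hy : y = x then x else τ ⟨y, hy⟩, fun u hu => ?_⟩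
  have hu' : u ≠ x := by simpa using hu
  have h1 := hτ ⟨u, hu'⟩
  have h2 := (τ ⟨u, hu'⟩).2
  simp only [hu', dite_false, Finset.mem_singleton, h2, not_false_eq_true, true_and]
  exact ⟨h1.1, by simp [h1.2]⟩

/-! ### Breaks in lists, and concatenation of the paths of a partition -/

open Classical in
/-- The number of consecutive pairs of a list that are not adjacent in `G`. -/
noncomputable def breaks {W : Type*} (G : SimpleGraph W) : List W → ℕ
  | [] => 0
  | [_] => 0
  | a :: b :: l => (if G.Adj a b then 0 else 1) + breaks G (b :: l)

lemma breaks_cons_le {W : Type*} (G : SimpleGraph W) (a : W) (l : List W) :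
    breaks G (a :: l) ≤ breaks G l + 1 := by
  rcases l with _ | ⟨b, l⟩
  · simp [breaks]
  · simp only [breaks]
    split_ifs <;> omega

lemma breaks_append_le {W : Type*} (G : SimpleGraph W) :
    ∀ l l' : List W, breaks G (l ++ l') ≤ breaks G l + breaks G l' + 1
  | [], l' => by simp [breaks]
  | [a], l' => by
      have := breaks_cons_le G a l'
      simp only [List.singleton_append, breaks]
      omega
  | a :: b :: l, l' => by
      have := breaks_append_le G (b :: l) l'
      simp only [List.cons_append, breaks] at this ⊢
      omega

lemma breaks_eq_zero {W : Type*} {G : SimpleGraph W} :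
    ∀ {l : List W}, l.IsChain G.Adj → breaks G l = 0
  | [], _ => rfl
  | [a], _ => rfl
  | a :: b :: l, h => by
      rw [List.isChain_cons_cons] at h
      simp [breaks, h.1, breaks_eq_zero h.2]

lemma breaks_flatten_le {W : Type*} {G : SimpleGraph W} :
    ∀ {L : List (List W)}, (∀ l ∈ L, l.IsChain G.Adj) → breaks G L.flatten ≤ L.length - 1
  | [], _ => by simp [breaks]
  | [l], h => by simpa using breaks_eq_zero (h l (by simp))
  | l :: l' :: L, h => by
      have h1 := breaks_eq_zero (h l (by simp))
      have h2 := breaks_flatten_le (L := l' :: L) (fun c hc => h c (List.mem_cons_of_mem _ hc))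
      have h3 := breaks_append_le G l (l' :: L).flatten
      rw [List.flatten_cons]
      simp only [List.length_cons] at h2 ⊢
      omega

/-- A partition of the vertices of `G` into paths `P i`. -/
structure IsPathPartition {W I : Type*} (G : SimpleGraph W) (P : I → List W) : Prop where
  ne_nil : ∀ i, P i ≠ []
  chain : ∀ i, (P i).IsChain G.Adj
  nodup : ∀ i, (P i).Nodup
  disjoint : ∀ i j w, w ∈ P i → w ∈ P j → i = j
  cover : ∀ w, ∃ i, w ∈ P i

/-- The path `P i`, traversed forwards or backwards. -/
def orient {W I : Type*} (P : I → List W) (s : I × Bool) : List W :=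
  if s.2 then P s.1 else (P s.1).reverse

lemma mem_orient {W I : Type*} {P : I → List W} {s : I × Bool} {w : W} :
    w ∈ orient P s ↔ w ∈ P s.1 := by
  unfold orient
  split_ifs <;> simp

lemma orient_not {W I : Type*} (P : I → List W) (s : I × Bool) :
    orient P (s.1, !s.2) = (orient P s).reverse := by
  unfold orient
  cases s.2 <;> simp

namespace IsPathPartition

variable {W I : Type*} {G : SimpleGraph W} {P : I → List W}

lemma orient_ne_nil (h : IsPathPartition G P) (s : I × Bool) : orient P s ≠ [] := by
  unfold orient
  split_ifs <;> simp [h.ne_nil]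

/-- The first vertex of an oriented path of the partition. -/
def port (h : IsPathPartition G P) (s : I × Bool) : W := (orient P s).head (h.orient_ne_nil s)

lemma port_mem (h : IsPathPartition G P) (s : I × Bool) : h.port s ∈ P s.1 :=
  mem_orient.1 (List.head_mem _)

lemma orient_head? (h : IsPathPartition G P) (s : I × Bool) :
    (orient P s).head? = some (h.port s) := List.head?_eq_some_head _

lemma orient_getLast? (h : IsPathPartition G P) (s : I × Bool) :
    (orient P s).getLast? = some (h.port (s.1, !s.2)) := by
  rw [← h.orient_head?, orient_not, List.head?_reverse]

/-- Adjacency between the ends of different paths of the partition. -/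
def portGraph (h : IsPathPartition G P) : SimpleGraph (I × Bool) where
  Adj s s' := s.1 ≠ s'.1 ∧ G.Adj (h.port s) (h.port s')
  symm := ⟨fun _ _ h => ⟨h.1.symm, h.2.symm⟩⟩
  loopless := ⟨fun _ h => h.1 rfl⟩

lemma chain_orient (h : IsPathPartition G P) (s : I × Bool) : (orient P s).IsChain G.Adj := by
  unfold orient
  split_ifs
  · exact h.chain _
  · rw [List.isChain_reverse]
    exact (h.chain _).imp fun _ _ h => h.symm

lemma nodup_orient (h : IsPathPartition G P) (s : I × Bool) : (orient P s).Nodup := by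
  unfold orient
  split_ifs <;> simp [h.nodup]

/-- Under the linking condition the paths of the partition can be concatenated so that each
resulting path consists of at least two of them. The path `i₀` can be put first if all
resulting paths consist of exactly two. -/
theorem exists_list [Fintype I] [DecidableEq I] (h : IsPathPartition G P)
    [DecidableRel h.portGraph.Adj]
    (hH : ∀ A : Finset (I × Bool),
      A.card ≤ 2 * (Finset.univ.filter fun s => ∃ a ∈ A, h.portGraph.Adj a s).card + 1) (i₀ : I) :
    ∃ (k : ℕ) (l : List W), 1 ≤ k ∧ 2 * k ≤ Fintype.card I ∧ l.Nodup ∧ (∀ w, w ∈ l) ∧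
      breaks G l + 1 ≤ k ∧
      (2 * k = Fintype.card I → ∃ b l', l = orient P (i₀, b) ++ l') := by
  obtain ⟨σ, hσ, hmeet⟩ := exists_linking h.portGraph hH
  obtain ⟨𝓛, hch, hnd, hall⟩ := exists_chains σ (fun s s' hs => ⟨(hσ s s' hs).1.1, (hσ s s' hs).2⟩)
    hmeet
  let R : I × Bool → I × Bool → Prop := fun o o' => h.portGraph.Adj (o.1, !o.2) o'
  have hchR : ∀ c ∈ 𝓛, 2 ≤ c.length ∧ c.IsChain R :=
    fun c hc => ⟨(hch c hc).1, (hch c hc).2.imp fun o o' ho => (hσ _ _ ho).1⟩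
  have hlen : ∀ L : List (List (I × Bool)), (L.flatten.map Prod.fst).Nodup →
      (∀ i, i ∈ L.flatten.map Prod.fst) → (L.map List.length).sum = Fintype.card I := by
    intro L h1 h2
    have : (L.flatten.map Prod.fst).toFinset = Finset.univ := by
      ext i
      simpa using h2 i
    rw [← Finset.card_univ, ← this, List.toFinset_card_of_nodup h1]
    rw [List.length_map, List.length_flatten]
  have hsum : ∀ L : List (List (I × Bool)), (∀ c ∈ L, 2 ≤ c.length) →
      2 * L.length ≤ (L.map List.length).sum := by
    intro L
    induction L with
    | nil => simp
    | cons c L ih =>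
      intro h1
      have h2 := ih fun c hc => h1 c (List.mem_cons_of_mem _ hc)
      have h3 := h1 c (by simp)
      simp only [List.length_cons, List.map_cons, List.sum_cons]
      omega
  have build : ∀ L : List (List (I × Bool)), (∀ c ∈ L, c.IsChain R) →
      (L.flatten.map Prod.fst).Nodup → (∀ i, i ∈ L.flatten.map Prod.fst) →
      (L.flatten.flatMap (orient P)).Nodup ∧ (∀ w, w ∈ L.flatten.flatMap (orient P)) ∧
      breaks G (L.flatten.flatMap (orient P)) ≤ L.length - 1 := by
    intro L h1 h2 h3
    refine ⟨?_, ?_, ?_⟩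
    · rw [List.nodup_flatMap]
      refine ⟨fun s _ => h.nodup_orient s, ?_⟩
      have h4 := List.pairwise_map.1 h2
      refine h4.imp fun {a b} hab => ?_
      refine fun w hw hw' => hab (h.disjoint _ _ w (mem_orient.1 hw) (mem_orient.1 hw'))
    · intro w
      obtain ⟨i, hi⟩ := h.cover w
      obtain ⟨s, hs, rfl⟩ := List.mem_map.1 (h3 i)
      exact List.mem_flatMap.2 ⟨s, hs, mem_orient.2 hi⟩
    · have h4 : L.flatten.flatMap (orient P) = (L.map fun c => c.flatMap (orient P)).flatten := by
        simp [List.flatMap_def, List.map_flatten, List.flatten_flatten, Function.comp_def]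
      rw [h4]
      refine (breaks_flatten_le ?_).trans (by simp)
      intro l hl
      obtain ⟨c, hc, rfl⟩ := List.mem_map.1 hl
      rw [List.flatMap_def, List.isChain_flatten]
      · refine ⟨?_, ?_⟩
        · intro l hl
          obtain ⟨s, -, rfl⟩ := List.mem_map.1 hl
          exact h.chain_orient s
        · rw [List.isChain_map]
          refine (h1 c hc).imp fun o o' ho => ?_
          rw [h.orient_getLast?, h.orient_head?]
          intro x hx y hy
          simp only [Option.mem_def, Option.some.injEq] at hx hy
          subst hx hy
          exact ho.2
      · simp only [List.mem_map, not_exists, not_and]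
        exact fun s _ => h.orient_ne_nil s
  obtain ⟨c, hc, o, ho, rfl⟩ : ∃ c ∈ 𝓛, ∃ o ∈ c, o.1 = i₀ := by
    obtain ⟨o, ho, rfl⟩ := List.mem_map.1 (hall i₀)
    obtain ⟨c, hc, hoc⟩ := List.mem_flatten.1 ho
    exact ⟨c, hc, o, hoc, rfl⟩
  have hp := List.perm_cons_erase hc
  have hpf := hp.flatten.map Prod.fst
  have hplen := hp.length_eq
  have hl1 := hlen 𝓛 hnd hall
  have hl2 := hsum 𝓛 (fun c hc => (hch c hc).1)
  simp only [List.length_cons] at hplen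
  have hor : ∀ d : List (I × Bool), d.IsChain R → (d.map Prod.fst).Perm (c.map Prod.fst) →
      ∃ l, l = (d :: 𝓛.erase c).flatten.flatMap (orient P) ∧ l.Nodup ∧ (∀ w, w ∈ l) ∧
        breaks G l + 1 ≤ 𝓛.length := by
    intro d hd hdp
    have hperm : ((d :: 𝓛.erase c).flatten.map Prod.fst).Perm (𝓛.flatten.map Prod.fst) := by
      refine List.Perm.trans ?_ hpf.symm
      simp only [List.flatten_cons, List.map_append]
      exact hdp.append_right _
    obtain ⟨h1, h2, h3⟩ := build (d :: 𝓛.erase c) (by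
        intro e he
        rcases List.mem_cons.1 he with rfl | he
        · exact hd
        · exact (hchR e (List.mem_of_mem_erase he)).2) (hperm.nodup_iff.2 hnd)
      (fun i => hperm.mem_iff.2 (hall i))
    refine ⟨_, rfl, h1, h2, ?_⟩
    simp only [List.length_cons] at h3
    omega
  by_cases heq : 2 * 𝓛.length = Fintype.card I
  -- Equality forces every chain to have exactly two pieces, so `i₀` is at an end of its chain.
  · have hc2 : c.length = 2 := by
      have h1 := hsum (𝓛.erase c) (fun c hc => (hch c (List.mem_of_mem_erase hc)).1)
      have h2 := (hp.map List.length).sum_eq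
      simp only [List.map_cons, List.sum_cons] at h2
      have := (hch c hc).1
      omega
    obtain ⟨o₁, o₂, rfl⟩ := List.length_eq_two.1 hc2
    simp only [List.mem_cons, List.not_mem_nil, or_false] at ho
    rcases ho with rfl | rfl
    · obtain ⟨l, hl, h1, h2, h3⟩ := hor _ (hchR _ hc).2 (List.Perm.refl _)
      refine ⟨𝓛.length, l, by omega, by omega, h1, h2, h3, fun _ =>
        ⟨o.2, (o₂ :: (𝓛.erase [o, o₂]).flatten).flatMap (orient P), ?_⟩⟩
      rw [hl]
      simp only [List.flatten_cons, List.cons_append, List.flatMap_cons]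
      rfl
    -- When `i₀` comes second, the chain is reversed, which flips the orientation of both pieces.
    · obtain ⟨l, hl, h1, h2, h3⟩ := hor [(o.1, !o.2), (o₁.1, !o₁.2)] (by
          have := (hchR _ hc).2
          simp only [List.isChain_cons_cons, List.isChain_singleton, and_true, R,
            Bool.not_not] at this ⊢
          exact this.symm)
        (by simpa using List.Perm.swap _ _ _)
      refine ⟨𝓛.length, l, by omega, by omega, h1, h2, h3, fun _ =>
        ⟨!o.2, ((o₁.1, !o₁.2) :: (𝓛.erase [o₁, o]).flatten).flatMap (orient P), ?_⟩⟩
      rw [hl]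
      simp only [List.flatten_cons, List.cons_append, List.nil_append, List.flatMap_cons]
  · obtain ⟨l, -, h1, h2, h3⟩ := hor _ (hchR _ hc).2 (List.Perm.refl _)
    exact ⟨𝓛.length, l, by omega, by omega, h1, h2, h3, fun h => absurd h heq⟩

end IsPathPartition

/-! ### Universal vertices and the linking condition -/

/-- Deleting the universal vertices from a list creates at most one break per deleted vertex. -/
lemma breaks_filterMap_le {V : Type*} (G : SimpleGraph V) (T : ℕ) :
    ∀ l : List (V ⊕ Fin T), breaks G (l.filterMap Sum.getLeft?) ≤
      breaks (addUniversal G T) l + l.countP Sum.isRight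
  | [] => by simp [breaks]
  | .inr d :: l => by
      have h1 := breaks_filterMap_le G T l
      have h2 : breaks (addUniversal G T) l ≤ breaks (addUniversal G T) (.inr d :: l) := by
        rcases l with _ | ⟨a, l⟩ <;> simp [breaks]
      simp only [List.filterMap_cons, Sum.getLeft?_inr, List.countP_cons, Sum.isRight_inr, if_true]
      omega
  | [.inl u] => by simp [breaks]
  | .inl u :: .inl v :: l => by
      classical
      have h1 := breaks_filterMap_le G T (.inl v :: l)
      have h2 : (if (addUniversal G T).Adj (.inl u) (.inl v) then 0 else 1)
          = if G.Adj u v then 0 else 1 := if_congr addUniversal_adj_inl rfl rfl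
      simp only [List.filterMap_cons, Sum.getLeft?_inl, List.countP_cons, Sum.isRight_inl,
        Bool.false_eq_true, if_false, add_zero] at h1 ⊢
      simp only [breaks]
      omega
  | .inl u :: .inr d :: l => by
      have h1 := breaks_filterMap_le G T l
      have h2 : breaks (addUniversal G T) l ≤ breaks (addUniversal G T) (.inr d :: l) := by
        rcases l with _ | ⟨a, l⟩ <;> simp [breaks]
      have h3 := breaks_cons_le G u (l.filterMap Sum.getLeft?)
      simp only [List.filterMap_cons, Sum.getLeft?_inl, Sum.getLeft?_inr, List.countP_cons,
        Sum.isRight_inl, Sum.isRight_inr, if_true]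
      simp only [breaks]
      simp
      omega

open Classical in
/-- The total weight at `u` of all pairs except those edges of `G` inside a path of `P`. -/
noncomputable def outWeight {V I : Type*} [Fintype V] {T : ℕ} (G : SimpleGraph V) (w : V → V → ℝ)
    (P : I → List (V ⊕ Fin T)) (u : V) : ℝ :=
  ∑ v, if G.Adj u v ∧ ∃ i, .inl u ∈ P i ∧ .inl v ∈ P i then 0 else w u v

/-- The linking condition holds for path partitions whose ends have sufficiently large weight to the
outside. The defects `δ` have to cover all the weight at vertices that are not ends. -/
theorem IsFracTour.card_le_ports {V I : Type*} [Fintype V] [DecidableEq V] [Fintype I]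
    [DecidableEq I] {G : SimpleGraph V} {w : V → V → ℝ} {t : ℝ} (hw : IsFracTour G w t) {T : ℕ}
    {P : I → List (V ⊕ Fin T)} (h : IsPathPartition (addUniversal G T) P)
    [DecidableRel h.portGraph.Adj]
    (hI : 2 ≤ Fintype.card I) (δ : V → ℝ) (hδ : ∀ u, 0 ≤ δ u)
    (hport : ∀ d : Fin T, ∃ s, h.port s = .inr d)
    (hmult : ∀ u, ((Finset.univ.filter fun s => h.port s = .inl u).card : ℝ)
      ≤ outWeight G w P u + δ u)
    (hinner : ∀ u, (∀ s, h.port s ≠ .inl u) → outWeight G w P u ≤ δ u)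
    (hlt : 2 * t + ∑ u, δ u < 2 * T + 2) (A : Finset (I × Bool)) :
    A.card ≤ 2 * (Finset.univ.filter fun s => ∃ a ∈ A, h.portGraph.Adj a s).card + 1 := by
  classical
  -- A universal end in `A` is adjacent to all ends of the other pieces. This gives |N(A)| ≥ 2|I| -
  -- 2, which suffices for |I| ≥ 2.
  by_cases hA : ∃ a ∈ A, ∃ d, h.port a = .inr d
  · obtain ⟨a, ha, d, hd⟩ := hA
    have h1 : A.card ≤ 2 * Fintype.card I := by
      have := A.card_le_univ
      rwa [Fintype.card_prod, Fintype.card_bool, mul_comm] at this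
    have h2 : (Finset.univ.erase a.1 ×ˢ (Finset.univ : Finset Bool)) ⊆
        Finset.univ.filter fun s => ∃ a ∈ A, h.portGraph.Adj a s := by
      intro s hs
      have hne : s.1 ≠ a.1 := by simpa using hs
      simp only [Finset.mem_filter, Finset.mem_univ, true_and]
      refine ⟨a, ha, hne.symm, ?_⟩
      have h3 : h.port s ≠ .inr d := by
        intro h4
        exact hne (h.disjoint _ _ _ (h.port_mem s) (by rw [h4, ← hd]; exact h.port_mem a))
      rw [hd]
      exact (addUniversal_adj_inr h3).symm
    have h3 := Finset.card_le_card h2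
    rw [Finset.card_product, Finset.card_erase_of_mem (Finset.mem_univ _), Finset.card_univ,
      Finset.card_univ, Fintype.card_bool] at h3
    omega
  push Not at hA
  rcases Nat.lt_or_ge 1 A.card with hA1 | hA1
  swap
  · omega
  set N := Finset.univ.filter fun s => ∃ a ∈ A, h.portGraph.Adj a s with hN
  set B : Finset V := Finset.univ.filter fun u => ∃ a ∈ A, h.port a = .inl u with hB
  set J : Finset V := Finset.univ.filter fun v => ∃ s ∈ N, h.port s = .inl v with hJ
  set Q : Finset V := Finset.univ.filter fun u => ∀ s, h.port s ≠ .inl u with hQ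
  -- All universal vertices occur as ends in `N`. Indeed, if `A` lay within the piece of such an
  -- end, then, having at least two elements, it would contain that end.
  have hJN : J.card + T ≤ N.card := by
    have h1 : J.map ⟨Sum.inl, Sum.inl_injective⟩ ∪
        (Finset.univ : Finset (Fin T)).map ⟨Sum.inr, Sum.inr_injective⟩ ⊆ N.image h.port := by
      intro x hx
      simp only [Finset.mem_union, Finset.mem_map, hJ, Finset.mem_filter, Finset.mem_univ,
        true_and, Function.Embedding.coeFn_mk] at hx
      rcases hx with ⟨v, ⟨s, hs, hsv⟩, rfl⟩ | ⟨d, rfl⟩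
      · exact Finset.mem_image.2 ⟨s, hs, hsv⟩
      · obtain ⟨s, hs⟩ := hport d
        refine Finset.mem_image.2 ⟨s, ?_, hs⟩
        obtain ⟨a, ha, hne⟩ : ∃ a ∈ A, a.1 ≠ s.1 := by
          by_contra hcon
          push Not at hcon
          have hsub : A ⊆ {(s.1, true), (s.1, false)} := by
            intro a ha
            have := hcon a ha
            rcases a with ⟨i, b⟩
            cases b <;> simp_all
          have hAeq := Finset.eq_of_subset_of_card_le hsub
            (by rw [Finset.card_pair (by simp)]; omega)
          have hsA : s ∈ A := by
            rw [hAeq]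
            rcases s with ⟨i, b⟩
            cases b <;> simp
          exact hA s hsA d hs
        simp only [hN, Finset.mem_filter, Finset.mem_univ, true_and]
        refine ⟨a, ha, hne, ?_⟩
        rw [hs]
        exact addUniversal_adj_inr (hA a ha d)
    have h2 := (Finset.card_le_card h1).trans Finset.card_image_le
    rwa [Finset.card_union_of_disjoint, Finset.card_map, Finset.card_map, Finset.card_univ,
      Fintype.card_fin] at h2
    rw [Finset.disjoint_left]
    intro x hx hx'
    simp only [Finset.mem_map, Function.Embedding.coeFn_mk] at hx hx'
    obtain ⟨i, -, rfl⟩ := hx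
    obtain ⟨s, -, h⟩ := hx'
    cases h
  have hAB : (A.card : ℝ) ≤ ∑ u ∈ B, (outWeight G w P u + δ u) := by
    have h1 : A ⊆ B.biUnion fun u => Finset.univ.filter fun s => h.port s = .inl u := by
      intro a ha
      rcases hp : h.port a with u | d
      · simp only [Finset.mem_biUnion, hB, Finset.mem_filter, Finset.mem_univ, true_and]
        exact ⟨u, ⟨a, ha, hp⟩, hp⟩
      · exact absurd hp (hA a ha d)
    have h2 := (Finset.card_le_card h1).trans Finset.card_biUnion_le
    refine (Nat.cast_le (α := ℝ).2 h2).trans ?_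
    push_cast
    exact Finset.sum_le_sum fun u _ => hmult u
  have hite : ∀ (p : Prop) [Decidable p] (u v : V), 0 ≤ if p then w u v else 0 := by
    intro p _ u v
    split_ifs
    · exact hw.nonneg _ _
    · exact le_rfl
  have hite' : ∀ (p : Prop) [Decidable p] (u v : V), 0 ≤ if p then 0 else w u v := by
    intro p _ u v
    split_ifs
    · exact le_rfl
    · exact hw.nonneg _ _
  let inn : V → V → Prop := fun u v => G.Adj u v ∧ ∃ i, Sum.inl u ∈ P i ∧ Sum.inl v ∈ P i
  have hinn : ∀ u v, inn u v ↔ inn v u := fun u v =>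
    ⟨fun ⟨h, i, h1, h2⟩ => ⟨h.symm, i, h2, h1⟩, fun ⟨h, i, h1, h2⟩ => ⟨h.symm, i, h2, h1⟩⟩
  -- Weight leaving the path at an end `u` goes to a non-neighbour, to an end adjacent to `u` on
  -- another path (hence in `J`), or to an interior vertex in `Q`. The three parts total at most 2t,
  -- 2|J| and the defects on `Q`.
  have hpt : ∀ u ∈ B, outWeight G w P u ≤ ∑ v, ((if G.Adj u v then 0 else w u v) +
      (if v ∈ J then w u v else 0) + if v ∈ Q then (if inn u v then 0 else w u v) else 0) := by
    intro u hu
    refine Finset.sum_le_sum fun v _ => ?_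
    have h1 := hite' (G.Adj u v) u v
    have h2 := hite (v ∈ J) u v
    have h3 : (0 : ℝ) ≤ if v ∈ Q then (if inn u v then 0 else w u v) else 0 := by
      split_ifs
      · exact le_rfl
      · exact hw.nonneg _ _
      · exact le_rfl
    by_cases hin : inn u v
    · rw [if_pos hin]
      linarith
    · rw [if_neg hin]
      by_cases hadj : G.Adj u v
      swap
      · rw [if_neg hadj]
        linarith
      by_cases hvQ : v ∈ Q
      · rw [if_pos hvQ, if_neg hin]
        linarith
      · have hvJ : v ∈ J := by
          simp only [hQ, Finset.mem_filter, Finset.mem_univ, true_and, not_forall, not_not] at hvQ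
          obtain ⟨s, hs⟩ := hvQ
          simp only [hB, Finset.mem_filter, Finset.mem_univ, true_and] at hu
          obtain ⟨a, ha, hau⟩ := hu
          simp only [hJ, hN, Finset.mem_filter, Finset.mem_univ, true_and]
          refine ⟨s, ⟨a, ha, ?_, ?_⟩, hs⟩
          · intro heq
            refine hin ⟨hadj, a.1, hau ▸ h.port_mem a, ?_⟩
            rw [heq, ← hs]
            exact h.port_mem s
          · rw [hau, hs]
            exact addUniversal_adj_inl.2 hadj
        rw [if_pos hvJ]
        linarith
  have htot : ∑ u ∈ B, outWeight G w P u ≤ 2 * t + 2 * J.card + ∑ u ∈ Q, outWeight G w P u := by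
    refine (Finset.sum_le_sum hpt).trans ?_
    refine (Finset.sum_le_sum_of_subset_of_nonneg (Finset.subset_univ B) ?_).trans ?_
    · intro u _ _
      refine Finset.sum_nonneg fun v _ => add_nonneg (add_nonneg (hite' _ _ _) (hite _ _ _)) ?_
      split_ifs
      · exact le_rfl
      · exact hw.nonneg _ _
      · exact le_rfl
    simp only [Finset.sum_add_distrib]
    rw [hw.slack]
    have h1 : ∑ u, ∑ v, (if v ∈ J then w u v else 0) = 2 * J.card := by
      rw [Finset.sum_comm]
      have : ∀ v ∈ (Finset.univ : Finset V), (∑ u, if v ∈ J then w u v else 0)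
          = if v ∈ J then 2 else 0 := by
        intro v _
        split_ifs
        · rw [← hw.degree v]
          exact Finset.sum_congr rfl fun u _ => hw.symm u v
        · simp
      rw [Finset.sum_congr rfl this, ← Finset.sum_filter]
      simp [mul_comm]
    have h2 : ∑ u, ∑ v, (if v ∈ Q then (if inn u v then 0 else w u v) else 0)
        = ∑ u ∈ Q, outWeight G w P u := by
      rw [Finset.sum_comm, ← Finset.sum_filter_add_sum_filter_not Finset.univ (· ∈ Q)]
      rw [Finset.sum_eq_zero (s := Finset.univ.filter fun v => v ∉ Q), add_zero]
      · rw [Finset.filter_mem_eq_inter, Finset.univ_inter]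
        refine Finset.sum_congr rfl fun v hv => Finset.sum_congr rfl fun u _ => ?_
        rw [if_pos hv, hw.symm u v]
        by_cases hin : inn v u
        · rw [if_pos ((hinn u v).2 hin)]
          exact (if_pos hin).symm
        · rw [if_neg (fun h => hin ((hinn u v).1 h))]
          exact (if_neg hin).symm
      · intro v hv
        simp only [Finset.mem_filter, Finset.mem_univ, true_and] at hv
        simp [hv]
    rw [h1, h2]
  have hδsum : ∑ u ∈ B, δ u + ∑ u ∈ Q, outWeight G w P u ≤ ∑ u, δ u := by
    have h1 : ∑ u ∈ Q, outWeight G w P u ≤ ∑ u ∈ Q, δ u :=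
      Finset.sum_le_sum fun u hu => hinner u (by simpa [hQ] using hu)
    have h2 : Disjoint B Q := by
      refine Finset.disjoint_left.2 fun u hu hu' => ?_
      simp only [hB, hQ, Finset.mem_filter, Finset.mem_univ, true_and] at hu hu'
      obtain ⟨a, -, ha⟩ := hu
      exact hu' a ha
    have h3 := Finset.sum_le_sum_of_subset_of_nonneg (Finset.subset_univ (B ∪ Q))
      (fun u _ _ => hδ u)
    rw [Finset.sum_union h2] at h3
    linarith
  rw [Finset.sum_add_distrib] at hAB
  -- The strict inequality `hlt` and integrality turn this into |A| ≤ 2(|J| + T) + 1.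
  have h4 : (A.card : ℝ) < (2 * (J.card + T) + 2 : ℕ) := by
    push_cast
    linarith
  have := Nat.cast_lt.1 h4
  omega

/-! ### Path partitions obtained from matchings -/

open Classical in
/-- The edges of a matching off `X` together with a path through `X`. -/
noncomputable def matchingPaths {W : Type*} [Fintype W] (X : Finset W) (σ : W → W) (xl : List W) :
    {u : W // u ∉ X ∧ Fintype.equivFin W u < Fintype.equivFin W (σ u)} ⊕ Fin (min 1 xl.length) →
      List W
  | .inl u => [u.1, σ u.1]
  | .inr _ => xl

/-- Each matching edge is indexed by its endpoint that comes first in a fixed enumeration. The index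
type `Fin (min 1 xl.length)` is empty for an empty `xl` and has one element otherwise, so that no
empty path arises. -/
lemma IsMatchingOff.exists_isPathPartition.{u} {W : Type u} [Fintype W] [DecidableEq W]
    {G : SimpleGraph W} {xl : List W} {σ : W → W} (hσ : IsMatchingOff G xl.toFinset σ)
    (hxl : xl.IsChain G.Adj) (hnd : xl.Nodup) :
    ∃ (I : Type u) (_ : Fintype I) (_ : DecidableEq I) (P : I → List W), IsPathPartition G P ∧
      2 * Fintype.card I + xl.length = Fintype.card W + 2 * min 1 xl.length ∧
      (∀ u, u ∉ xl → ∃ i, P i = [u, σ u] ∨ P i = [σ u, u]) ∧ (xl ≠ [] → ∃ i, P i = xl) := by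
  classical
  set e := Fintype.equivFin W
  have hne : ∀ u, u ∉ xl.toFinset → e u ≠ e (σ u) := fun u hu h =>
    (hσ u hu).2.1.ne (e.injective h)
  have hinv : ∀ u, u ∉ xl.toFinset → ∀ v, v ∉ xl.toFinset → σ u = v → σ v = u := by
    intro u hu v _ h
    rw [← h]
    exact (hσ u hu).2.2
  refine ⟨_, inferInstance, inferInstance, matchingPaths xl.toFinset σ xl, ?_, ?_, ?_, ?_⟩
  · refine ⟨?_, ?_, ?_, ?_, ?_⟩
    · rintro (u | j)
      · simp [matchingPaths]
      · have := j.pos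
        simp only [matchingPaths]
        rintro rfl
        simp at this
    · rintro (u | j)
      · simp [matchingPaths, (hσ _ u.2.1).2.1]
      · exact hxl
    · rintro (u | j)
      · simp [matchingPaths, (hσ _ u.2.1).2.1.ne]
      · exact hnd
    · rintro (⟨u, hu, hu'⟩ | j) (⟨v, hv, hv'⟩ | j') w h1 h2
      · simp only [matchingPaths, List.mem_cons, List.not_mem_nil, or_false] at h1 h2
        have : u = v := by
          rcases h1 with rfl | rfl <;> rcases h2 with h2 | h2
          · exact h2
          · have h3 := hinv v hv _ hu h2.symm
            rw [h3, h2] at hu'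
            exact absurd hu' hv'.asymm
          · have h3 := hinv u hu _ hv h2
            rw [h3, ← h2] at hv'
            exact absurd hv' hu'.asymm
          · rw [← (hσ u hu).2.2, h2, (hσ v hv).2.2]
        subst this
        rfl
      · simp only [matchingPaths, List.mem_cons, List.not_mem_nil, or_false] at h1 h2
        rcases h1 with rfl | rfl
        · exact absurd (List.mem_toFinset.2 h2) hu
        · exact absurd (List.mem_toFinset.2 h2) (hσ u hu).1
      · simp only [matchingPaths, List.mem_cons, List.not_mem_nil, or_false] at h1 h2
        rcases h2 with rfl | rfl
        · exact absurd (List.mem_toFinset.2 h1) hv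
        · exact absurd (List.mem_toFinset.2 h1) (hσ v hv).1
      · congr 1
        have := j.2
        have := j'.2
        ext
        omega
    · intro w
      by_cases hw : w ∈ xl
      · refine ⟨.inr ⟨0, ?_⟩, hw⟩
        have := List.length_pos_of_mem hw
        omega
      · have hw' : w ∉ xl.toFinset := by simpa using hw
        rcases lt_or_gt_of_ne (hne w hw') with h | h
        · exact ⟨.inl ⟨w, hw', h⟩, by simp [matchingPaths]⟩
        · exact ⟨.inl ⟨σ w, (hσ w hw').1, by rw [(hσ w hw').2.2]; exact h⟩,
            by simp [matchingPaths, (hσ w hw').2.2]⟩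
  · rw [Fintype.card_sum, Fintype.card_fin, Fintype.card_subtype]
    set D := Finset.univ.filter fun u => u ∉ xl.toFinset ∧ e u < e (σ u) with hD
    set E := Finset.univ.filter fun u => u ∉ xl.toFinset ∧ e (σ u) < e u with hE
    have h1 : D.card = E.card := by
      refine Finset.card_bij' (fun u _ => σ u) (fun u _ => σ u) ?_ ?_ ?_ ?_
      · intro u hu
        simp only [hD, hE, Finset.mem_filter, Finset.mem_univ, true_and] at hu ⊢
        exact ⟨(hσ u hu.1).1, by rw [(hσ u hu.1).2.2]; exact hu.2⟩
      · intro u hu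
        simp only [hD, hE, Finset.mem_filter, Finset.mem_univ, true_and] at hu ⊢
        exact ⟨(hσ u hu.1).1, by rw [(hσ u hu.1).2.2]; exact hu.2⟩
      · intro u hu
        exact (hσ u (Finset.mem_filter.1 hu).2.1).2.2
      · intro u hu
        exact (hσ u (Finset.mem_filter.1 hu).2.1).2.2
    have h2 : D.card + E.card = (xl.toFinsetᶜ).card := by
      rw [← Finset.card_union_of_disjoint]
      · congr 1
        ext u
        simp only [hD, hE, Finset.mem_union, Finset.mem_filter, Finset.mem_univ, true_and,
          Finset.mem_compl]
        constructor
        · rintro (h | h) <;> exact h.1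
        · intro h
          rcases lt_or_gt_of_ne (hne u h) with h3 | h3
          · exact Or.inl ⟨h, h3⟩
          · exact Or.inr ⟨h, h3⟩
      · refine Finset.disjoint_left.2 fun u hu hu' => ?_
        exact (Finset.mem_filter.1 hu).2.2.asymm (Finset.mem_filter.1 hu').2.2
    have h3 := Finset.card_add_card_compl xl.toFinset
    rw [List.toFinset_card_of_nodup hnd] at h3
    omega
  · intro u hu
    have hu' : u ∉ xl.toFinset := by simpa using hu
    rcases lt_or_gt_of_ne (hne u hu') with h | h
    · exact ⟨.inl ⟨u, hu', h⟩, Or.inl rfl⟩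
    · refine ⟨.inl ⟨σ u, (hσ u hu').1, by rw [(hσ u hu').2.2]; exact h⟩, Or.inr ?_⟩
      simp [matchingPaths, (hσ u hu').2.2]
  · intro h
    exact ⟨.inr ⟨0, by have := List.length_pos_iff.2 h; omega⟩, rfl⟩

namespace IsPathPartition

variable {W I : Type*} {G : SimpleGraph W} {P : I → List W}

lemma fst_eq_of_port_eq (h : IsPathPartition G P) {s : I × Bool} {i : I} {x : W} (hx : x ∈ P i)
    (hs : h.port s = x) : s.1 = i :=
  h.disjoint _ _ x (hs ▸ h.port_mem s) hx

lemma card_port_le_two [Fintype I] (h : IsPathPartition G P) (x : W)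
    [DecidablePred fun s => h.port s = x] :
    (Finset.univ.filter fun s => h.port s = x).card ≤ 2 := by
  classical
  obtain ⟨i, hi⟩ := h.cover x
  have : (Finset.univ.filter fun s => h.port s = x) ⊆ {(i, true), (i, false)} := by
    intro s hs
    have := h.fst_eq_of_port_eq hi (Finset.mem_filter.1 hs).2
    rcases s with ⟨j, b⟩
    cases b <;> simp_all
  exact (Finset.card_le_card this).trans Finset.card_le_two

lemma card_port_le_one [Fintype I] (h : IsPathPartition G P) {x : W} {i : I} (hi : x ∈ P i)
    (h2 : 2 ≤ (P i).length) [DecidablePred fun s => h.port s = x] :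
    (Finset.univ.filter fun s => h.port s = x).card ≤ 1 := by
  rw [Finset.card_le_one]
  have key : h.port (i, true) ≠ h.port (i, false) := by
    unfold port orient
    simp only [if_true, Bool.false_eq_true, if_false, List.head_reverse]
    intro heq
    have hnd := h.nodup i
    rw [List.head_eq_getElem, List.getLast_eq_getElem, hnd.getElem_inj_iff] at heq
    omega
  intro s hs s' hs'
  simp only [Finset.mem_filter, Finset.mem_univ, true_and] at hs hs'
  have h1 := h.fst_eq_of_port_eq hi hs
  have h2 := h.fst_eq_of_port_eq hi hs'
  obtain ⟨j, b⟩ := s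
  obtain ⟨j', b'⟩ := s'
  simp only at h1 h2
  subst h1 h2
  cases b <;> cases b' <;> simp_all

lemma exists_port_of_head (h : IsPathPartition G P) {x : W} {i : I} {l : List W}
    (hi : P i = x :: l) : h.port (i, true) = x := by
  have := h.orient_head? (i, true)
  simp only [orient, hi, if_true, List.head?_cons, Option.some.injEq] at this
  exact this.symm

lemma exists_port_of_getLast (h : IsPathPartition G P) {x : W} {i : I} {l : List W}
    (hi : P i = l ++ [x]) : h.port (i, false) = x := by
  have := h.orient_head? (i, false)
  simp only [orient, hi, Bool.false_eq_true, if_false, List.reverse_append, List.reverse_singleton,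
    List.singleton_append, List.head?_cons, Option.some.injEq] at this
  exact this.symm

end IsPathPartition

/-! ### Listings of the vertices with few breaks -/

section

variable {V I : Type*} [Fintype V] [DecidableEq V] {G : SimpleGraph V} {w : V → V → ℝ} {t : ℝ}
  {T : ℕ} {P : I → List (V ⊕ Fin T)}

lemma IsFracTour.outWeight_eq (hw : IsFracTour G w t) (h : IsPathPartition (addUniversal G T) P)
    {u : V} {i : I} (hu : .inl u ∈ P i) {F : Finset V}
    (hF : ∀ v, v ∈ F ↔ G.Adj u v ∧ .inl v ∈ P i) :
    outWeight G w P u = 2 - ∑ v ∈ F, w u v := by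
  classical
  have h1 : ∑ v ∈ F, w u v = ∑ v, if v ∈ F then w u v else 0 := by
    rw [← Finset.sum_filter, Finset.filter_mem_eq_inter, Finset.univ_inter]
  rw [← hw.degree u, h1, ← Finset.sum_sub_distrib, outWeight]
  refine Finset.sum_congr rfl fun v _ => ?_
  have h2 : (G.Adj u v ∧ ∃ j, .inl u ∈ P j ∧ .inl v ∈ P j) ↔ v ∈ F := by
    rw [hF]
    constructor
    · rintro ⟨h3, j, h4, h5⟩
      rw [h.disjoint _ _ _ h4 hu] at h5
      exact ⟨h3, h5⟩
    · rintro ⟨h3, h4⟩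
      exact ⟨h3, i, hu, h4⟩
  by_cases hv : v ∈ F
  · rw [if_pos (h2.2 hv), if_pos hv, sub_self]
  · rw [if_neg (fun h => hv (h2.1 h)), if_neg hv, sub_zero]

/-- Of the degree 2 at `u`, its only companion on the path accounts for at most 1. -/
lemma IsFracTour.one_le_outWeight (hw : IsFracTour G w t)
    (h : IsPathPartition (addUniversal G T) P) {u : V} {i : I} {y : V ⊕ Fin T}
    (hi : P i = [.inl u, y] ∨ P i = [y, .inl u]) : 1 ≤ outWeight G w P u := by
  classical
  have hmem : ∀ x, x ∈ P i ↔ x = .inl u ∨ x = y := by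
    intro x
    rcases hi with hi | hi <;> simp [hi, or_comm]
  rw [hw.outWeight_eq h ((hmem _).2 (Or.inl rfl))
    (F := Finset.univ.filter fun v => G.Adj u v ∧ .inl v ∈ P i) (by simp)]
  have h1 : (Finset.univ.filter fun v => G.Adj u v ∧ .inl v ∈ P i).card ≤ 1 := by
    rw [Finset.card_le_one]
    intro a ha b hb
    simp only [hmem, Finset.mem_filter, Finset.mem_univ, true_and, Sum.inl.injEq] at ha hb
    have h2 := ha.2.resolve_left ha.1.ne'
    have h3 := hb.2.resolve_left hb.1.ne'
    rw [← h3] at h2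
    exact Sum.inl_injective h2
  have h2 := Finset.sum_le_card_nsmul (Finset.univ.filter fun v => G.Adj u v ∧ .inl v ∈ P i)
    (w u) 1 (fun v _ => hw.le_one u v)
  rw [nsmul_eq_mul, mul_one] at h2
  have h3 : ((Finset.univ.filter fun v => G.Adj u v ∧ .inl v ∈ P i).card : ℝ) ≤ 1 := by
    exact_mod_cast h1
  linarith

/-- An even number of vertices, including the universal ones. -/
lemma IsFracTour.exists_list_even (hw : IsFracTour G w t) (ht : t < T + 1)
    (heven : Even (Fintype.card V + T)) (hcard : 4 ≤ Fintype.card V + T) :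
    ∃ (k : ℕ) (l : List (V ⊕ Fin T)), 4 * k ≤ Fintype.card V + T ∧ l.Nodup ∧ (∀ x, x ∈ l) ∧
      breaks (addUniversal G T) l + 1 ≤ k := by
  classical
  obtain ⟨σ, hσ⟩ := exists_isMatchingOff_empty (addUniversal G T) (by simpa using heven)
    (fun S 𝒞 => hw.card_le_of_separates ht)
  obtain ⟨I, _, _, P, hP, hI, hpair, -⟩ :=
    IsMatchingOff.exists_isPathPartition (xl := []) (by simpa using hσ) (by simp) (by simp)
  simp only [List.length_nil, add_zero, Fintype.card_sum, Fintype.card_fin] at hI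
  have hI' : 2 * Fintype.card I = Fintype.card V + T := by simpa using hI
  obtain ⟨i₀⟩ : Nonempty I := Fintype.card_pos_iff.1 (by omega)
  have hlink : ∀ A : Finset (I × Bool), A.card ≤
      2 * (Finset.univ.filter fun s => ∃ a ∈ A, hP.portGraph.Adj a s).card + 1 := by
    refine hw.card_le_ports hP (by omega) (fun _ => 0) (fun _ => le_rfl) ?_ ?_ ?_ ?_
    · intro d
      obtain ⟨i, hi | hi⟩ := hpair (.inr d) (by simp)
      · exact ⟨_, hP.exists_port_of_head hi⟩
      · exact ⟨_, hP.exists_port_of_getLast (l := [_]) hi⟩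
    · intro u
      obtain ⟨i, hi⟩ := hpair (.inl u) (by simp)
      have h1 := hw.one_le_outWeight hP hi
      have h2 := hP.card_port_le_one (x := .inl u) (i := i) (by rcases hi with hi | hi <;> simp [hi])
        (by rcases hi with hi | hi <;> simp [hi])
      have h3 : ((Finset.univ.filter fun s => hP.port s = .inl u).card : ℝ) ≤ 1 := by
        exact_mod_cast h2
      linarith
    · intro u hu
      obtain ⟨i, hi | hi⟩ := hpair (.inl u) (by simp)
      · exact absurd (hP.exists_port_of_head hi) (hu _)
      · exact absurd (hP.exists_port_of_getLast (l := [_]) hi) (hu _)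
    · simp only [Finset.sum_const_zero]
      linarith
  obtain ⟨k, l, -, hk, h1, h2, h3, -⟩ := hP.exists_list hlink i₀
  exact ⟨k, l, by omega, h1, h2, h3⟩

/-- An odd number of vertices, including the universal ones, one of which is a path of its own. -/
lemma IsFracTour.exists_list_odd (hw : IsFracTour G w t) (ht : t < T + 1)
    (hodd : Odd (Fintype.card V + T)) (hcard : 4 ≤ Fintype.card V + T) (x : V ⊕ Fin T) :
    ∃ (k : ℕ) (l : List (V ⊕ Fin T)), 4 * k ≤ Fintype.card V + T + 1 ∧ l.Nodup ∧ (∀ x, x ∈ l) ∧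
      breaks (addUniversal G T) l + 1 ≤ k ∧
      (4 * k = Fintype.card V + T + 1 → ∃ l', l = x :: l') := by
  classical
  obtain ⟨σ, hσ⟩ := exists_isMatchingOff_singleton (addUniversal G T) (by simpa using hodd)
    (fun S 𝒞 => hw.card_le_of_separates ht) x
  obtain ⟨I, _, _, P, hP, hI, hpair, hx⟩ :=
    IsMatchingOff.exists_isPathPartition (xl := [x]) (by simpa using hσ) (by simp) (by simp)
  simp only [List.length_singleton, min_self, Fintype.card_sum, Fintype.card_fin] at hI
  obtain ⟨i₀, hi₀⟩ := hx (by simp)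
  have hlink : ∀ A : Finset (I × Bool), A.card ≤
      2 * (Finset.univ.filter fun s => ∃ a ∈ A, hP.portGraph.Adj a s).card + 1 := by
    refine hw.card_le_ports hP (by omega) (fun _ => 0) (fun _ => le_rfl) ?_ ?_ ?_ ?_
    · intro d
      by_cases hd : Sum.inr d = x
      · exact ⟨_, hP.exists_port_of_head (hd ▸ hi₀)⟩
      obtain ⟨i, hi | hi⟩ := hpair (.inr d) (by simpa using hd)
      · exact ⟨_, hP.exists_port_of_head hi⟩
      · exact ⟨_, hP.exists_port_of_getLast (l := [_]) hi⟩
    · intro u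
      by_cases hu : Sum.inl u = x
      · rw [hw.outWeight_eq hP (u := u) (i := i₀) (F := ∅) (by simp [hi₀, hu])]
        · have h2 := hP.card_port_le_two (.inl u)
          have h3 : ((Finset.univ.filter fun s => hP.port s = .inl u).card : ℝ) ≤ 2 := by
            exact_mod_cast h2
          simpa using h3
        · intro v
          simp only [hi₀, ← hu, List.mem_singleton, Sum.inl.injEq, Finset.notMem_empty, false_iff,
            not_and]
          rintro h5 rfl
          exact h5.ne rfl
      obtain ⟨i, hi⟩ := hpair (.inl u) (by simpa using hu)
      have h1 := hw.one_le_outWeight hP hi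
      have h2 := hP.card_port_le_one (x := .inl u) (i := i) (by rcases hi with hi | hi <;> simp [hi])
        (by rcases hi with hi | hi <;> simp [hi])
      have h3 : ((Finset.univ.filter fun s => hP.port s = .inl u).card : ℝ) ≤ 1 := by
        exact_mod_cast h2
      linarith
    · intro u hu
      by_cases hux : Sum.inl u = x
      · exact absurd (hP.exists_port_of_head (hux ▸ hi₀)) (hu _)
      obtain ⟨i, hi | hi⟩ := hpair (.inl u) (by simpa using hux)
      · exact absurd (hP.exists_port_of_head hi) (hu _)
      · exact absurd (hP.exists_port_of_getLast (l := [_]) hi) (hu _)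
    · simp only [Finset.sum_const_zero]
      linarith
  obtain ⟨k, l, -, hk, h1, h2, h3, h4⟩ := hP.exists_list hlink i₀
  refine ⟨k, l, by omega, h1, h2, h3, fun h5 => ?_⟩
  obtain ⟨b, l', hl⟩ := h4 (by omega)
  refine ⟨l', ?_⟩
  rw [hl]
  cases b <;> simp [orient, hi₀]

end

section

variable {V : Type*} [Fintype V] [DecidableEq V] {G : SimpleGraph V} {w : V → V → ℝ} {t : ℝ}

open Classical in
/-- An odd number of vertices, three of which form a path `p, q, r` of the partition. -/
lemma IsFracTour.exists_list_triple (hw : IsFracTour G w t) (hcard : 5 ≤ Fintype.card V)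
    {p q r : V} (hpq : G.Adj p q) (hqr : G.Adj q r) (hpr : p ≠ r) {σ : V ⊕ Fin 0 → V ⊕ Fin 0}
    (hσ : IsMatchingOff (addUniversal G 0) {.inl p, .inl q, .inl r} σ) {a b c : ℝ}
    (ha : 0 ≤ a) (hb : 0 ≤ b) (hc : 0 ≤ c)
    (hpa : 1 ≤ 2 - w p q - (if G.Adj p r then w p r else 0) + a)
    (hqb : 2 - w p q - w q r ≤ b)
    (hrc : 1 ≤ 2 - w q r - (if G.Adj p r then w p r else 0) + c)
    (hlt : 2 * t + a + b + c < 2) :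
    ∃ (k : ℕ) (l : List (V ⊕ Fin 0)), 4 * k + 1 ≤ Fintype.card V ∧ l.Nodup ∧ (∀ x, x ∈ l) ∧
      breaks (addUniversal G 0) l + 1 ≤ k := by
  obtain ⟨I, _, _, P, hP, hI, hpair, hx⟩ :=
    IsMatchingOff.exists_isPathPartition (G := addUniversal G 0) (σ := σ)
      (xl := [.inl p, .inl q, .inl r]) (by simpa using hσ)
      (by simp [addUniversal_adj_inl, hpq, hqr]) (by simp [hpq.ne, hqr.ne, hpr])
  obtain ⟨i₀, hi₀⟩ := hx (by simp)
  have hI' : 2 * Fintype.card I + 1 = Fintype.card V := by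
    simp at hI
    omega
  have hp0 : hP.port (i₀, true) = .inl p := hP.exists_port_of_head hi₀
  have hr0 : hP.port (i₀, false) = .inl r := hP.exists_port_of_getLast (l := [_, _]) hi₀
  have hmem : ∀ v, Sum.inl v ∈ P i₀ ↔ v = p ∨ v = q ∨ v = r := by simp [hi₀]
  have hwp : outWeight G w P p = 2 - w p q - (if G.Adj p r then w p r else 0) := by
    rw [hw.outWeight_eq hP ((hmem p).2 (Or.inl rfl))
      (F := {q} ∪ if G.Adj p r then {r} else ∅)]
    · split_ifs with h
      · rw [Finset.sum_union (by simpa using hqr.ne)]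
        simp only [Finset.sum_singleton]
        ring
      · simp
    · intro v
      rw [hmem]
      split_ifs with h <;> simp only [Finset.mem_union, Finset.mem_singleton, Finset.notMem_empty]
      · constructor
        · rintro (rfl | rfl) <;> simp [hpq, h]
        · rintro ⟨h1, rfl | rfl | rfl⟩
          · exact absurd rfl h1.ne
          · exact Or.inl rfl
          · exact Or.inr rfl
      · constructor
        · rintro (rfl | h)
          · simp [hpq]
          · exact h.elim
        · rintro ⟨h1, rfl | rfl | rfl⟩
          · exact absurd rfl h1.ne
          · exact Or.inl rfl
          · exact absurd h1 h
  have hwr : outWeight G w P r = 2 - w q r - (if G.Adj p r then w p r else 0) := by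
    rw [hw.outWeight_eq hP ((hmem r).2 (Or.inr (Or.inr rfl)))
      (F := {q} ∪ if G.Adj p r then {p} else ∅), hw.symm q r, hw.symm p r]
    · split_ifs with h
      · rw [Finset.sum_union (by simpa using hpq.ne')]
        simp only [Finset.sum_singleton]
        ring
      · simp
    · intro v
      rw [hmem]
      split_ifs with h <;> simp only [Finset.mem_union, Finset.mem_singleton, Finset.notMem_empty]
      · constructor
        · rintro (rfl | rfl) <;> simp [hqr.symm, h.symm]
        · rintro ⟨h1, rfl | rfl | rfl⟩
          · exact Or.inr rfl
          · exact Or.inl rfl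
          · exact absurd rfl h1.ne
      · constructor
        · rintro (rfl | h)
          · simp [hqr.symm]
          · exact h.elim
        · rintro ⟨h1, rfl | rfl | rfl⟩
          · exact absurd h1.symm h
          · exact Or.inl rfl
          · exact absurd rfl h1.ne
  have hwq : outWeight G w P q = 2 - w p q - w q r := by
    rw [hw.outWeight_eq hP ((hmem q).2 (Or.inr (Or.inl rfl))) (F := {p, r}),
      Finset.sum_pair hpr, hw.symm p q]
    · ring
    · intro v
      rw [hmem]
      simp only [Finset.mem_insert, Finset.mem_singleton]
      constructor
      · rintro (rfl | rfl) <;> simp [hpq.symm, hqr]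
      · rintro ⟨h1, rfl | rfl | rfl⟩
        · exact Or.inl rfl
        · exact absurd rfl h1.ne
        · exact Or.inr rfl
  have hqport : ∀ s, hP.port s ≠ .inl q := by
    intro s hs
    have h1 := hP.fst_eq_of_port_eq ((hmem q).2 (Or.inr (Or.inl rfl))) hs
    obtain ⟨j, b⟩ := s
    simp only at h1
    subst h1
    cases b
    · rw [hr0] at hs
      exact hqr.ne (Sum.inl_injective hs).symm
    · rw [hp0] at hs
      exact hpq.ne (Sum.inl_injective hs)
  -- The defects `a` and `c` raise the weight available at the ends `p` and `r` to 1; `b` pays for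
  -- the weight that is lost at the interior vertex `q`.
  let δ : V → ℝ := fun u =>
    (if u = p then a else 0) + (if u = q then b else 0) + if u = r then c else 0
  have hδp : δ p = a := by simp [δ, hpq.ne, hpr]
  have hδq : δ q = b := by simp [δ, hpq.ne', hqr.ne]
  have hδr : δ r = c := by simp [δ, hpr.symm, hqr.ne']
  have hδ : ∀ u, 0 ≤ δ u := by
    intro u
    refine add_nonneg (add_nonneg ?_ ?_) ?_ <;> split_ifs <;> simp [ha, hb, hc]
  have hδsum : ∑ u, δ u = a + b + c := by
    simp [δ, Finset.sum_add_distrib]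
  have hone : ∀ u : V, ∀ i, Sum.inl u ∈ P i → 2 ≤ (P i).length →
      ((Finset.univ.filter fun s => hP.port s = .inl u).card : ℝ) ≤ 1 := by
    intro u i h1 h2
    exact_mod_cast hP.card_port_le_one h1 h2
  have hlink : ∀ A : Finset (I × Bool), A.card ≤
      2 * (Finset.univ.filter fun s => ∃ a ∈ A, hP.portGraph.Adj a s).card + 1 := by
    refine hw.card_le_ports hP (by omega) δ hδ (fun d => d.elim0) ?_ ?_ ?_
    · intro u
      by_cases hup : u = p
      · subst hup
        have := hone u i₀ ((hmem u).2 (Or.inl rfl)) (by simp [hi₀])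
        linarith
      by_cases huq : u = q
      · subst huq
        rw [Finset.filter_false_of_mem fun s _ => hqport s]
        have := hδ u
        have h3 : 0 ≤ outWeight G w P u := by
          have h4 := hw.le_one p u
          have h5 := hw.le_one u r
          linarith
        simp only [Finset.card_empty, Nat.cast_zero]
        linarith
      by_cases hur : u = r
      · subst hur
        have := hone u i₀ ((hmem u).2 (Or.inr (Or.inr rfl))) (by simp [hi₀])
        linarith
      obtain ⟨i, hi⟩ := hpair (.inl u) (by simp [hup, huq, hur])
      have h1 := hw.one_le_outWeight hP hi
      have h2 := hone u i (by rcases hi with hi | hi <;> simp [hi])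
        (by rcases hi with hi | hi <;> simp [hi])
      have h3 := hδ u
      linarith
    · intro u hu
      by_cases hup : u = p
      · subst hup
        exact absurd hp0 (hu _)
      by_cases huq : u = q
      · subst huq
        rw [hwq, hδq]
        exact hqb
      by_cases hur : u = r
      · subst hur
        exact absurd hr0 (hu _)
      obtain ⟨i, hi | hi⟩ := hpair (.inl u) (by simp [hup, huq, hur])
      · exact absurd (hP.exists_port_of_head hi) (hu _)
      · exact absurd (hP.exists_port_of_getLast (l := [_]) hi) (hu _)
    · rw [hδsum]
      push_cast
      linarith
  obtain ⟨k, l, -, hk, h1, h2, h3, -⟩ := hP.exists_list hlink i₀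
  exact ⟨k, l, by omega, h1, h2, h3⟩

/-- Every vertex has a neighbour along which the weight is at least average. -/
lemma IsFracTour.exists_adj_le (hw : IsFracTour G w t) (ht : t < 2) (v : V) :
    ∃ a, G.Adj v a ∧ 2 - t ≤ (Fintype.card V - 1 : ℝ) * w v a := by
  classical
  have hna : ∀ u v, 0 ≤ if G.Adj u v then 0 else w u v := by
    intro u v
    split_ifs
    · exact le_rfl
    · exact hw.nonneg _ _
  -- The slack counts every non-adjacent pair at `v` twice and totals 2t.
  have h1 : ∑ a, (if G.Adj v a then 0 else w v a) ≤ t := by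
    have h2 := hw.slack
    rw [← Finset.add_sum_erase _ _ (Finset.mem_univ v)] at h2
    have h3 : ∑ a, (if G.Adj v a then 0 else w v a) ≤
        ∑ u ∈ Finset.univ.erase v, ∑ a, (if G.Adj u a then 0 else w u a) := by
      rw [← Finset.add_sum_erase _ _ (Finset.mem_univ v), hw.self, ite_self, zero_add]
      refine Finset.sum_le_sum fun u _ => ?_
      rw [hw.symm v u]
      refine le_trans (le_of_eq ?_)
        (Finset.single_le_sum (fun a _ => hna u a) (Finset.mem_univ v))
      by_cases h : G.Adj u v
      · rw [if_pos h, if_pos h.symm]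
      · rw [if_neg h, if_neg (fun h' => h h'.symm)]
    have h4 : ∑ a, (if G.Adj v a then 0 else w v a) +
        ∑ u ∈ Finset.univ.erase v, ∑ a, (if G.Adj u a then 0 else w u a) = 2 * t := by
      convert h2
    linarith
  have h2 : 2 - t ≤ ∑ a ∈ Finset.univ.filter (G.Adj v), w v a := by
    have h3 := hw.degree v
    have h4 : ∑ a, w v a = ∑ a, (if G.Adj v a then 0 else w v a) +
        ∑ a, (if G.Adj v a then w v a else 0) := by
      rw [← Finset.sum_add_distrib]
      refine Finset.sum_congr rfl fun a _ => ?_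
      split_ifs <;> ring
    rw [← Finset.sum_filter] at h4
    linarith
  have hne : (Finset.univ.filter (G.Adj v)).Nonempty := by
    by_contra h
    rw [Finset.not_nonempty_iff_eq_empty.1 h, Finset.sum_empty] at h2
    linarith
  obtain ⟨a, ha, hmax⟩ := Finset.exists_max_image _ (w v) hne
  refine ⟨a, (Finset.mem_filter.1 ha).2, h2.trans ?_⟩
  refine (Finset.sum_le_card_nsmul _ _ _ hmax).trans ?_
  rw [nsmul_eq_mul]
  refine mul_le_mul_of_nonneg_right ?_ (hw.nonneg _ _)
  have h5 : (Finset.univ.filter (G.Adj v)).card ≤ (Finset.univ.erase v).card :=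
    Finset.card_le_card fun a ha => by
      simpa using (Finset.mem_filter.1 ha).2.ne'
  rw [Finset.card_erase_of_mem (Finset.mem_univ _), Finset.card_univ] at h5
  have h6 : 1 ≤ Fintype.card V := Fintype.card_pos_iff.2 ⟨v⟩
  have h7 : ((Finset.univ.filter (G.Adj v)).card : ℝ) ≤ (Fintype.card V - 1 : ℕ) := by
    exact_mod_cast h5
  rwa [Nat.cast_sub h6, Nat.cast_one] at h7

lemma IsFracTour.triangle_le (hw : IsFracTour G w t) (hcard : 4 ≤ Fintype.card V) {p q r : V}
    (hpq : p ≠ q) (hqr : q ≠ r) (hpr : p ≠ r) : w p q + w q r + w p r ≤ 2 := by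
  have h1 := hw.cut {p, q, r} (by simp) (by
    intro h
    have h2 := Finset.card_le_three (a := p) (b := q) (c := r)
    rw [h, Finset.card_univ] at h2
    omega)
  have h2 : ∀ u, ∑ v ∈ ({p, q, r} : Finset V)ᶜ, w u v = 2 - (w u p + (w u q + w u r)) := by
    intro u
    have h3 := Finset.sum_add_sum_compl ({p, q, r} : Finset V) (w u)
    rw [hw.degree u, Finset.sum_insert (by simp [hpq, hpr]), Finset.sum_pair hqr] at h3
    linarith
  simp only [h2] at h1
  rw [Finset.sum_insert (by simp [hpq, hpr]), Finset.sum_pair hqr] at h1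
  have := hw.self p
  have := hw.self q
  have := hw.self r
  have := hw.symm p q
  have := hw.symm q r
  have := hw.symm p r
  linarith

/-- If the weight of non-edges is small, an odd number of vertices can be treated like the even
number below it. -/
lemma IsFracTour.exists_list_odd' (hw : IsFracTour G w t) (hodd : Odd (Fintype.card V))
    (hcard : 5 ≤ Fintype.card V)
    (ht : (3 * (Fintype.card V - 1 : ℝ) + 1) * t < 2) :
    ∃ (k : ℕ) (l : List (V ⊕ Fin 0)), 4 * k + 1 ≤ Fintype.card V ∧ l.Nodup ∧ (∀ x, x ∈ l) ∧
      breaks (addUniversal G 0) l + 1 ≤ k := by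
  classical
  have hcardR : (5 : ℝ) ≤ Fintype.card V := by exact_mod_cast hcard
  have ht1 : t < 1 := by nlinarith
  obtain ⟨v⟩ : Nonempty V := Fintype.card_pos_iff.1 (by omega)
  obtain ⟨σ, hσ⟩ := exists_isMatchingOff_singleton (addUniversal G 0) (by simpa using hodd)
    (fun S 𝒞 => hw.card_le_of_separates (by simpa using ht1)) (.inl v)
  obtain ⟨a, hva, hmax⟩ := hw.exists_adj_le (by linarith) v
  -- The factor 3 is needed below: the two heaviest sides of a triangle carry at least 2/3 of its
  -- weight, which must exceed 2t.
  have hξ : 3 * t < w v a := by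
    have h1 : (Fintype.card V - 1 : ℝ) * (3 * t) < (Fintype.card V - 1 : ℝ) * w v a := by linarith
    exact lt_of_mul_lt_mul_left h1 (by linarith)
  have hav := hva.ne'
  obtain ⟨h1, h2, h3⟩ := hσ (.inl a) (by simpa using hav)
  rcases hb : σ (.inl a) with b | d
  swap
  · exact d.elim0
  rw [hb] at h1 h2 h3
  rw [addUniversal_adj_inl] at h2
  have hbv : b ≠ v := by simpa using h1
  have hσ' : IsMatchingOff (addUniversal G 0) {.inl v, .inl a, .inl b} σ := by
    intro u hu
    simp only [Finset.mem_insert, Finset.mem_singleton, not_or] at hu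
    obtain ⟨h4, h5, h6⟩ := hσ u (by simpa using hu.1)
    refine ⟨?_, h5, h6⟩
    simp only [Finset.mem_insert, Finset.mem_singleton, not_or] at h4 ⊢
    refine ⟨h4, ?_, ?_⟩
    · intro h7
      rw [h7, hb] at h6
      exact hu.2.2 h6.symm
    · intro h7
      rw [h7, h3] at h6
      exact hu.2.1 h6.symm
  have n1 := hw.nonneg v a
  have n2 := hw.nonneg a b
  have n3 := hw.nonneg v b
  have l1 := hw.le_one v a
  have l2 := hw.le_one a b
  have l3 := hw.le_one v b
  by_cases hvb : G.Adj v b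
  swap
  · refine hw.exists_list_triple hcard hva h2 hbv.symm hσ' (a := 0) (b := 2 - w v a - w a b) (c := 0)
      le_rfl (by linarith) le_rfl ?_ le_rfl ?_ (by linarith)
    · rw [if_neg hvb]
      linarith
    · rw [if_neg hvb]
      linarith
  have hX := hw.triangle_le (by omega) hva.ne h2.ne hbv.symm
  -- In a triangle the path of three vertices uses the two heaviest sides `x` and `y` and closes
  -- over the lightest side `z`. If both maxima vanish, x + y > 2t is needed; if one does, z is at
  -- most the side to be compared and 2t < 1; if neither does, the sum is 2t + 2z with z ≤ 2/3 and t
  -- < 1/3.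
  have num : ∀ x y z : ℝ, 0 ≤ x → 0 ≤ y → 0 ≤ z → x ≤ 1 → y ≤ 1 → z ≤ 1 → x + y + z ≤ 2 →
      3 * t < x + y + z → z ≤ x → z ≤ y → 9 * t < 3 * (x + y + z) → 3 * t < 1 →
      2 * t + max 0 (x + z - 1) + (2 - x - y) + max 0 (y + z - 1) < 2 := by
    intro x y z h1 h2 h3 h4 h5 h6 h7 h8 h9 h10 h11 h12
    rcases max_cases 0 (x + z - 1) with ⟨e1, -⟩ | ⟨e1, -⟩ <;>
      rcases max_cases 0 (y + z - 1) with ⟨e2, -⟩ | ⟨e2, -⟩ <;> rw [e1, e2] <;> linarith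
  have s1 := hw.symm v a
  have s2 := hw.symm a b
  have s3 := hw.symm v b
  have ht3 : 3 * t < 1 := by linarith
  have hab := h2
  rcases le_total (w v a) (w a b) with c1 | c1
  · rcases le_total (w v a) (w v b) with c2 | c2
    · refine hw.exists_list_triple hcard hvb hab.symm hva.ne
        (by convert hσ' using 1; ext; simp; tauto)
        (a := max 0 (w v b + w v a - 1)) (b := 2 - w v b - w b a) (c := max 0 (w a b + w v a - 1))
        (le_max_left _ _) (by linarith) (le_max_left _ _) ?_ le_rfl ?_ ?_
      · rw [if_pos hva]
        have := le_max_right 0 (w v b + w v a - 1)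
        linarith
      · rw [if_pos hva]
        have := le_max_right 0 (w a b + w v a - 1)
        linarith
      · have := num (w v b) (w a b) (w v a)
        rw [← s2]
        apply this <;> linarith
    · refine hw.exists_list_triple hcard hva hab hbv.symm hσ'
        (a := max 0 (w v a + w v b - 1)) (b := 2 - w v a - w a b) (c := max 0 (w a b + w v b - 1))
        (le_max_left _ _) (by linarith) (le_max_left _ _) ?_ le_rfl ?_ ?_
      · rw [if_pos hvb]
        have := le_max_right 0 (w v a + w v b - 1)
        linarith
      · rw [if_pos hvb]
        have := le_max_right 0 (w a b + w v b - 1)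
        linarith
      · have := num (w v a) (w a b) (w v b)
        apply this <;> linarith
  · rcases le_total (w a b) (w v b) with c2 | c2
    · refine hw.exists_list_triple hcard hva.symm hvb hab.ne
        (by convert hσ' using 1; ext; simp; tauto)
        (a := max 0 (w v a + w a b - 1)) (b := 2 - w a v - w v b) (c := max 0 (w v b + w a b - 1))
        (le_max_left _ _) (by linarith) (le_max_left _ _) ?_ le_rfl ?_ ?_
      · rw [if_pos hab]
        have := le_max_right 0 (w v a + w a b - 1)
        linarith
      · rw [if_pos hab]
        have := le_max_right 0 (w v b + w a b - 1)
        linarith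
      · have := num (w v a) (w v b) (w a b)
        rw [← s1]
        apply this <;> linarith
    · refine hw.exists_list_triple hcard hva hab hbv.symm hσ'
        (a := max 0 (w v a + w v b - 1)) (b := 2 - w v a - w a b) (c := max 0 (w a b + w v b - 1))
        (le_max_left _ _) (by linarith) (le_max_left _ _) ?_ le_rfl ?_ ?_
      · rw [if_pos hvb]
        have := le_max_right 0 (w v a + w v b - 1)
        linarith
      · rw [if_pos hvb]
        have := le_max_right 0 (w a b + w v b - 1)
        linarith
      · have := num (w v a) (w a b) (w v b)
        apply this <;> linarith

/-- A graph with a fractional tour has a listing of its vertices with few breaks. -/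
theorem IsFracTour.exists_list_breaks_le (hw : IsFracTour G w t) (hcard : 4 ≤ Fintype.card V)
    (ht0 : 0 ≤ t) :
    ∃ l : List V, l.Nodup ∧ (∀ v, v ∈ l) ∧
      15 * ((breaks G l : ℝ) + 1) ≤ 4 * Fintype.card V + 19 * t := by
  classical
  set n := Fintype.card V with hn
  obtain ⟨T, hT, htT⟩ : ∃ T : ℕ, (T : ℝ) ≤ t ∧ t < T + 1 :=
    ⟨⌊t⌋₊, Nat.floor_le ht0, Nat.lt_floor_add_one t⟩
  have key : ∀ (T : ℕ) (l : List (V ⊕ Fin T)), l.Nodup → (∀ x, x ∈ l) →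
      (l.filterMap Sum.getLeft?).Nodup ∧ (∀ v, v ∈ l.filterMap Sum.getLeft?) ∧
      breaks G (l.filterMap Sum.getLeft?) ≤ breaks (addUniversal G T) l + T ∧
      (∀ d l', l = .inr d :: l' →
        breaks G (l.filterMap Sum.getLeft?) + 1 ≤ breaks (addUniversal G T) l + T) := by
    intro T l h1 h2
    have hcount : l.countP Sum.isRight = T := by
      have h3 : (l.filter Sum.isRight).toFinset =
          (Finset.univ : Finset (Fin T)).map ⟨Sum.inr, Sum.inr_injective⟩ := by
        ext x
        rcases x with v | d <;> simp [h2]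
      rw [List.countP_eq_length_filter, ← List.toFinset_card_of_nodup (h1.filter _), h3,
        Finset.card_map, Finset.card_univ, Fintype.card_fin]
    refine ⟨?_, ?_, ?_, ?_⟩
    · refine h1.filterMap ?_
      intro x y v hx hy
      simp only [Option.mem_def, Sum.getLeft?_eq_some_iff] at hx hy
      rw [hx, hy]
    · intro v
      exact List.mem_filterMap.2 ⟨.inl v, h2 _, rfl⟩
    · have := breaks_filterMap_le G T l
      rwa [hcount] at this
    -- A universal vertex at the head of the list is deleted without creating a break.
    · rintro d l' rfl
      have h3 := breaks_filterMap_le G T l'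
      simp only [List.countP_cons, Sum.isRight_inr, if_true] at hcount
      simp only [List.filterMap_cons, Sum.getLeft?_inr]
      have h4 : breaks (addUniversal G T) l' ≤ breaks (addUniversal G T) (.inr d :: l') := by
        rcases l' with _ | ⟨a, l⟩ <;> simp [breaks]
      omega
  rcases Nat.even_or_odd (n + T) with heven | hodd
  · obtain ⟨k, l, hk, h1, h2, h3⟩ := hw.exists_list_even htT heven (by omega)
    obtain ⟨k1, k2, k3, -⟩ := key T l h1 h2
    refine ⟨_, k1, k2, ?_⟩
    have h4 : 4 * (breaks G (l.filterMap Sum.getLeft?) + 1) ≤ n + T + 4 * T := by omega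
    have h5 : (4 : ℝ) * (breaks G (l.filterMap Sum.getLeft?) + 1) ≤ n + T + 4 * T := by
      exact_mod_cast h4
    have : (0 : ℝ) ≤ n := Nat.cast_nonneg n
    linarith
  rcases Nat.eq_zero_or_pos T with rfl | hTpos
  -- Here 4k ≤ n + 1. This gives 15k ≤ 4n if n ≥ 15, or if n ≡ 1 mod 4, where in fact 4k ≤ n - 1.
  -- What remains is n = 7 with k ≤ 2 and n = 11 with k ≤ 3, where 19t must cover 2 and 1
  -- respectively. The threshold on t reads 19t ≥ 2 and 31t ≥ 2.
  · by_cases hsmall : 15 ≤ n ∨ n % 4 = 1 ∨ (2 : ℝ) ≤ (3 * (n - 1 : ℝ) + 1) * t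
    · obtain ⟨v⟩ : Nonempty V := Fintype.card_pos_iff.1 (by omega)
      obtain ⟨k, l, hk, h1, h2, h3, -⟩ := hw.exists_list_odd htT hodd (by omega) (.inl v)
      obtain ⟨k1, k2, k3, -⟩ := key 0 l h1 h2
      refine ⟨_, k1, k2, ?_⟩
      simp only [add_zero] at hodd hk k3
      have hkR : ((breaks G (l.filterMap Sum.getLeft?) : ℝ) + 1) ≤ k := by
        have : breaks G (l.filterMap Sum.getLeft?) + 1 ≤ k := by omega
        exact_mod_cast this
      have hmain : 15 * k ≤ 4 * n → 15 * ((breaks G (l.filterMap Sum.getLeft?) : ℝ) + 1) ≤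
          4 * n + 19 * t := by
        intro h
        have h4 : (15 : ℝ) * k ≤ 4 * n := by exact_mod_cast h
        linarith
      by_cases h15 : 15 * k ≤ 4 * n
      · exact hmain h15
      have hodd' := Nat.odd_iff.1 hodd
      have hn711 : n = 7 ∨ n = 11 := by
        rcases hsmall with h | h | h <;> omega
      rw [← hn] at hk
      rcases hn711 with h7 | h7 <;> rw [h7] at hsmall hk ⊢
      · have hk2 : (k : ℝ) ≤ 2 := by
          have : k ≤ 2 := by omega
          exact_mod_cast this
        norm_num at hsmall ⊢
        linarith
      · have hk2 : (k : ℝ) ≤ 3 := by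
          have : k ≤ 3 := by omega
          exact_mod_cast this
        norm_num at hsmall ⊢
        linarith
    · push Not at hsmall
      simp only [add_zero] at hodd
      have hodd' := Nat.odd_iff.1 hodd
      obtain ⟨k, l, hk, h1, h2, h3⟩ := hw.exists_list_odd' hodd (by omega) hsmall.2.2
      obtain ⟨k1, k2, k3, -⟩ := key 0 l h1 h2
      refine ⟨_, k1, k2, ?_⟩
      have h4 : 4 * (breaks G (l.filterMap Sum.getLeft?) + 1) ≤ n := by omega
      have h5 : (4 : ℝ) * (breaks G (l.filterMap Sum.getLeft?) + 1) ≤ n := by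
        exact_mod_cast h4
      have : (0 : ℝ) ≤ n := Nat.cast_nonneg n
      linarith
  · obtain ⟨k, l, hk, h1, h2, h3, h4⟩ := hw.exists_list_odd htT hodd (by omega) (.inr ⟨0, hTpos⟩)
    obtain ⟨k1, k2, k3, k4⟩ := key T l h1 h2
    refine ⟨_, k1, k2, ?_⟩
    -- If k attains (n + T + 1)/4, the universal vertex at the head saves one break; otherwise 4k ≤
    -- n + T already.
    have h5 : 4 * (breaks G (l.filterMap Sum.getLeft?) + 1) ≤ n + T + 4 * T := by
      by_cases heq : 4 * k = n + T + 1
      · obtain ⟨l', hl'⟩ := h4 heq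
        have := k4 _ _ hl'
        omega
      · have := Nat.odd_iff.1 hodd
        omega
    have h6 : (4 : ℝ) * (breaks G (l.filterMap Sum.getLeft?) + 1) ≤ n + T + 4 * T := by
      exact_mod_cast h5
    have : (0 : ℝ) ≤ n := Nat.cast_nonneg n
    linarith

end

/-! ### From listings of the cities to tours -/

section

variable {V : Type*} [Fintype V] [DecidableEq V]

/-- The graph of the edges of cost `1`. -/
def costOneGraph (c : Sym2 V → ℝ) : SimpleGraph V where
  Adj u v := u ≠ v ∧ c s(u, v) = 1
  symm := ⟨fun u v h => ⟨h.1.symm, by rw [Sym2.eq_swap]; exact h.2⟩⟩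
  loopless := ⟨fun _ h => h.1 rfl⟩

lemma mem_edges_iff {u v : V} : s(u, v) ∈ edges V ↔ u ≠ v := by
  simp [edges]

lemma cost_le_two {c : Sym2 V → ℝ} (hc : ∀ e ∈ edges V, c e = 1 ∨ c e = 2) {e : Sym2 V}
    (he : e ∈ edges V) : c e ≤ 2 := by
  rcases hc e he with h | h <;> rw [h]
  norm_num

lemma walk_cost_le {c : Sym2 V → ℝ} (hc : ∀ e ∈ edges V, c e = 1 ∨ c e = 2) :
    ∀ {u v : V} (p : (⊤ : SimpleGraph V).Walk u v),
      (p.edges.map c).sum ≤ p.length + breaks (costOneGraph c) p.support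
  | _, _, .nil => by simp
  | _, _, .cons (u := u) (v := v) h p => by
      have ih := walk_cost_le hc p
      have huv : u ≠ v := h
      rw [← p.cons_tail_support] at ih
      rw [SimpleGraph.Walk.support_cons, ← p.cons_tail_support]
      simp only [SimpleGraph.Walk.edges_cons, List.map_cons, List.sum_cons,
        SimpleGraph.Walk.length_cons, breaks]
      push_cast
      rcases hc _ (mem_edges_iff.2 huv) with h1 | h1
      · rw [if_pos ⟨huv, h1⟩, h1]
        linarith
      · rw [if_neg (fun h2 => by have := h2.2; linarith), h1]
        linarith

/-- An ordering of the cities closes up to a tour. -/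
lemma exists_tour_of_list {c : Sym2 V → ℝ} (hV : 3 ≤ Fintype.card V)
    (hc : ∀ e ∈ edges V, c e = 1 ∨ c e = 2) {l : List V} (hl : l.Nodup) (hmem : ∀ v, v ∈ l) :
    ∃ (v : V) (p : (⊤ : SimpleGraph V).Walk v v), p.IsHamiltonianCycle ∧
      walkCost c p ≤ Fintype.card V + breaks (costOneGraph c) l + 1 := by
  have hlen : l.length = Fintype.card V := by
    rw [← List.toFinset_card_of_nodup hl, ← Finset.card_univ]
    congr 1
    ext v
    simpa using hmem v
  have hne : l ≠ [] := by
    rintro rfl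
    simp at hlen
    omega
  have hchain : l.IsChain (⊤ : SimpleGraph V).Adj := (List.Pairwise.imp (fun h => h) hl).isChain
  set p := SimpleGraph.Walk.ofSupport l hne hchain with hp
  have hsupp : p.support = l := SimpleGraph.Walk.support_ofSupport hne hchain
  have hplen : p.length = Fintype.card V - 1 := by
    rw [hp, SimpleGraph.Walk.length_ofSupport, hlen]
  have hpath : p.IsPath := by
    rw [SimpleGraph.Walk.isPath_def, hsupp]
    exact hl
  have hends : l.getLast hne ≠ l.head hne := by
    intro h
    have h0 := (SimpleGraph.Walk.isPath_iff_nil (p := p.copy rfl h)).1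
      ((SimpleGraph.Walk.isPath_copy _ _ _).2 hpath)
    have := SimpleGraph.Walk.length_eq_zero_iff.2 h0
    rw [SimpleGraph.Walk.length_copy] at this
    omega
  have hcyc : (SimpleGraph.Walk.cons (G := ⊤) hends p).IsCycle := by
    refine SimpleGraph.Walk.isCycle_iff_isPath_tail_and_le_length.2 ⟨by simpa using hpath, ?_⟩
    rw [SimpleGraph.Walk.length_cons]
    omega
  refine ⟨_, _, SimpleGraph.Walk.isHamiltonianCycle_iff_isCycle_and_length_eq.2 ⟨hcyc, ?_⟩, ?_⟩
  · rw [SimpleGraph.Walk.length_cons, hplen]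
    omega
  · have h1 := walk_cost_le hc p
    have h2 := cost_le_two hc (mem_edges_iff.2 hends)
    have h3 : (p.length : ℝ) + 1 = Fintype.card V := by
      rw [hplen]
      exact_mod_cast (by omega : Fintype.card V - 1 + 1 = Fintype.card V)
    rw [hsupp] at h1
    simp only [walkCost, SimpleGraph.Walk.edges_cons, List.map_cons, List.sum_cons]
    linarith

lemma tourCosts_nonempty {c : Sym2 V → ℝ} (hV : 3 ≤ Fintype.card V)
    (hc : ∀ e ∈ edges V, c e = 1 ∨ c e = 2) : (tourCosts c).Nonempty := by
  obtain ⟨v, p, hp, -⟩ := exists_tour_of_list hV hc (Finset.nodup_toList Finset.univ)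
    (fun v => by simp)
  exact ⟨_, v, p, hp, rfl⟩

lemma walk_cost_natCast {c : Sym2 V → ℝ} (hc : ∀ e ∈ edges V, c e = 1 ∨ c e = 2) :
    ∀ {u v : V} (p : (⊤ : SimpleGraph V).Walk u v),
      ∃ m : ℕ, m ≤ 2 * p.length ∧ (m : ℝ) = (p.edges.map c).sum
  | _, _, .nil => ⟨0, by simp, by simp⟩
  | _, _, .cons (u := u) (v := v) h p => by
      obtain ⟨m, hm, hm'⟩ := walk_cost_natCast hc p
      simp only [SimpleGraph.Walk.edges_cons, List.map_cons, List.sum_cons,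
        SimpleGraph.Walk.length_cons]
      rcases hc _ (mem_edges_iff.2 h) with h1 | h1 <;> rw [h1, ← hm']
      · exact ⟨m + 1, by omega, by push_cast; ring⟩
      · exact ⟨m + 2, by omega, by push_cast; ring⟩

/-- Tour costs are integers between 0 and 2n. -/
lemma tourCosts_finite {c : Sym2 V → ℝ} (hc : ∀ e ∈ edges V, c e = 1 ∨ c e = 2) :
    (tourCosts c).Finite := by
  refine ((Set.finite_Iic (2 * Fintype.card V)).image (Nat.cast : ℕ → ℝ)).subset ?_
  rintro _ ⟨v, p, hp, rfl⟩
  obtain ⟨m, hm, hm'⟩ := walk_cost_natCast hc p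
  rw [hp.length_eq] at hm
  exact ⟨m, hm, hm'⟩

lemma isLeast_optTour {c : Sym2 V → ℝ} (hV : 3 ≤ Fintype.card V)
    (hc : ∀ e ∈ edges V, c e = 1 ∨ c e = 2) : IsLeast (tourCosts c) (optTour c) :=
  ⟨(tourCosts_nonempty hV hc).csInf_mem (tourCosts_finite hc),
    fun _ h => csInf_le (tourCosts_finite hc).bddBelow h⟩

end

/-! ### Solutions of the subtour LP as fractional tours -/

section

variable {V : Type*} [DecidableEq V]

/-- The weight of the pair `u, v` in a solution of the subtour LP. -/
def pairWeight (x : Sym2 V → ℝ) (u v : V) : ℝ := if u = v then 0 else x s(u, v)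

lemma pairWeight_self (x : Sym2 V → ℝ) (u : V) : pairWeight x u u = 0 := if_pos rfl

lemma pairWeight_of_ne (x : Sym2 V → ℝ) {u v : V} (h : u ≠ v) : pairWeight x u v = x s(u, v) :=
  if_neg h

lemma pairWeight_symm (x : Sym2 V → ℝ) (u v : V) : pairWeight x u v = pairWeight x v u := by
  simp only [pairWeight, eq_comm (a := u), Sym2.eq_swap (a := u)]

variable [Fintype V]

lemma cut_subset_edges (S : Finset V) : cut S ⊆ edges V := Finset.filter_subset _ _

lemma sum_cut (S : Finset V) (f : Sym2 V → ℝ) :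
    ∑ e ∈ cut S, f e = ∑ u ∈ S, ∑ v ∈ Sᶜ, f s(u, v) := by
  rw [← Finset.sum_product']
  symm
  refine Finset.sum_bij (fun a _ => s(a.1, a.2)) ?_ ?_ ?_ (fun _ _ => rfl)
  · rintro ⟨u, v⟩ h
    simp only [Finset.mem_product, Finset.mem_compl] at h
    refine Finset.mem_filter.2 ⟨mem_edges_iff.2 fun (huv : u = v) => ?_, u, h.1, v, h.2, rfl⟩
    exact h.2 (huv ▸ h.1)
  · rintro ⟨u, v⟩ h ⟨u', v'⟩ h' heq
    simp only [Finset.mem_product, Finset.mem_compl] at h h'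
    rcases Sym2.eq_iff.1 heq with ⟨h1, h2⟩ | ⟨h1, h2⟩
    · simp only at h1 h2
      rw [h1, h2]
    · simp only at h1 h2
      exact absurd (h1 ▸ h.1) h'.2
  · intro e he
    obtain ⟨-, u, hu, v, hv, rfl⟩ := Finset.mem_filter.1 he
    exact ⟨(u, v), by simp [hu, hv], rfl⟩

lemma mem_cut_singleton {a b u : V} (hab : a ≠ b) : s(a, b) ∈ cut {u} ↔ u = a ∨ u = b := by
  simp only [cut, Finset.mem_filter, mem_edges_iff, Finset.mem_singleton]
  constructor
  · rintro ⟨-, i, rfl, j, -, h⟩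
    rcases Sym2.eq_iff.1 h with ⟨h1, -⟩ | ⟨-, h1⟩
    · exact .inl h1.symm
    · exact .inr h1.symm
  · rintro (rfl | rfl)
    · exact ⟨hab, u, rfl, b, hab.symm, rfl⟩
    · exact ⟨hab, u, rfl, a, hab, Sym2.eq_swap⟩

lemma sum_sum_cut_singleton (f : Sym2 V → ℝ) :
    ∑ u : V, ∑ e ∈ cut {u}, f e = 2 * ∑ e ∈ edges V, f e := by
  have h : ∀ u : V, ∑ e ∈ cut {u}, f e = ∑ e ∈ edges V, if e ∈ cut {u} then f e else 0 := by
    intro u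
    rw [← Finset.sum_filter, Finset.filter_mem_eq_inter,
      Finset.inter_eq_right.2 (cut_subset_edges _)]
  simp_rw [h]
  rw [Finset.sum_comm, Finset.mul_sum]
  refine Finset.sum_congr rfl fun e he => ?_
  induction e with
  | _ a b =>
    have hab := mem_edges_iff.1 he
    have : (Finset.univ.filter fun u : V => s(a, b) ∈ cut {u}) = {a, b} := by
      ext u
      simp [mem_cut_singleton hab]
    rw [← Finset.sum_filter, this, Finset.sum_pair hab]
    ring

lemma sum_cut_eq_pairWeight (x : Sym2 V → ℝ) (S : Finset V) :
    ∑ e ∈ cut S, x e = ∑ u ∈ S, ∑ v ∈ Sᶜ, pairWeight x u v := by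
  rw [sum_cut]
  refine Finset.sum_congr rfl fun u hu => Finset.sum_congr rfl fun v hv => ?_
  rw [pairWeight_of_ne]
  rintro rfl
  exact Finset.mem_compl.1 hv hu

lemma sum_cut_singleton_eq_pairWeight (x : Sym2 V → ℝ) (u : V) :
    ∑ e ∈ cut {u}, x e = ∑ v, pairWeight x u v := by
  rw [sum_cut_eq_pairWeight, Finset.sum_singleton,
    ← Finset.sum_add_sum_compl {u} (fun v => pairWeight x u v), Finset.sum_singleton,
    pairWeight_self, zero_add]

lemma sum_sum_pairWeight (x : Sym2 V → ℝ) :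
    ∑ u, ∑ v, pairWeight x u v = 2 * ∑ e ∈ edges V, x e := by
  rw [← sum_sum_cut_singleton]
  exact Finset.sum_congr rfl fun u _ => (sum_cut_singleton_eq_pairWeight x u).symm

lemma sum_cut_compl (x : Sym2 V → ℝ) (S : Finset V) :
    ∑ e ∈ cut Sᶜ, x e = ∑ e ∈ cut S, x e := by
  rw [sum_cut_eq_pairWeight, sum_cut_eq_pairWeight, compl_compl, Finset.sum_comm]
  exact Finset.sum_congr rfl fun u _ => Finset.sum_congr rfl fun v _ => pairWeight_symm x v u

namespace IsSubtourFeasible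

variable {x : Sym2 V → ℝ}

lemma pairWeight_nonneg (hx : IsSubtourFeasible x) (u v : V) : 0 ≤ pairWeight x u v := by
  by_cases h : u = v
  · rw [h, pairWeight_self]
  · rw [pairWeight_of_ne x h]
    exact (hx.bounds _ (mem_edges_iff.2 h)).1

lemma pairWeight_le_one (hx : IsSubtourFeasible x) (u v : V) : pairWeight x u v ≤ 1 := by
  by_cases h : u = v
  · rw [h, pairWeight_self]
    exact zero_le_one
  · rw [pairWeight_of_ne x h]
    exact (hx.bounds _ (mem_edges_iff.2 h)).2

lemma sum_pairWeight (hx : IsSubtourFeasible x) (u : V) : ∑ v, pairWeight x u v = 2 := by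
  rw [← sum_cut_singleton_eq_pairWeight, hx.degree]

/-- For two vertices, the degrees contribute 4 and the pair between them removes at most 2, by the
upper bound on `x`. -/
lemma two_le_sum_cut_of_card_le_two (hx : IsSubtourFeasible x) {S : Finset V} (hS : S.Nonempty)
    (hcard : S.card ≤ 2) : 2 ≤ ∑ e ∈ cut S, x e := by
  rcases (by have := hS.card_pos; omega : S.card = 1 ∨ S.card = 2) with h | h
  · obtain ⟨u, rfl⟩ := Finset.card_eq_one.1 h
    exact (hx.degree u).ge
  · obtain ⟨u, v, huv, rfl⟩ := Finset.card_eq_two.1 h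
    have h1 := hx.sum_pairWeight u
    have h2 := hx.sum_pairWeight v
    rw [← Finset.sum_add_sum_compl {u, v}, Finset.sum_pair huv, pairWeight_self] at h1 h2
    rw [pairWeight_symm] at h2
    have h3 := hx.pairWeight_le_one u v
    rw [sum_cut_eq_pairWeight, Finset.sum_pair huv]
    linarith

/-- The sizes that the LP leaves out follow from the small case, applied to `S` or to its
complement. -/
lemma two_le_sum_cut (hx : IsSubtourFeasible x) {S : Finset V} (hS : S.Nonempty)
    (hS' : S ≠ Finset.univ) : 2 ≤ ∑ e ∈ cut S, x e := by
  have hcompl := S.card_add_card_compl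
  by_cases h1 : S.card ≤ 2
  · exact hx.two_le_sum_cut_of_card_le_two hS h1
  by_cases h2 : Sᶜ.card ≤ 2
  · rw [← sum_cut_compl]
    exact hx.two_le_sum_cut_of_card_le_two
      (Finset.nonempty_iff_ne_empty.2 fun h => hS' (Finset.compl_eq_empty_iff _ |>.1 h)) h2
  · exact hx.subtour S (by omega) (by omega)

-- The degree constraints give total weight n, so the cost exceeds n by precisely the weight on
-- edges of cost 2.
open Classical in
lemma isFracTour (hx : IsSubtourFeasible x) {c : Sym2 V → ℝ}
    (hc : ∀ e ∈ edges V, c e = 1 ∨ c e = 2) :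
    IsFracTour (costOneGraph c) (pairWeight x) (lpCost c x - Fintype.card V) where
  symm := pairWeight_symm x
  nonneg := hx.pairWeight_nonneg
  le_one := hx.pairWeight_le_one
  self := pairWeight_self x
  degree := hx.sum_pairWeight
  cut S hS hS' := by
    rw [← sum_cut_eq_pairWeight]
    exact hx.two_le_sum_cut hS hS'
  slack := by
    have h1 := sum_sum_pairWeight fun e => c e * x e
    have h2 : ∀ u v, (if (costOneGraph c).Adj u v then 0 else pairWeight x u v) =
        pairWeight (fun e => c e * x e) u v - pairWeight x u v := by
      intro u v
      by_cases huv : u = v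
      · subst huv
        simp [pairWeight_self]
      · rw [pairWeight_of_ne _ huv, pairWeight_of_ne _ huv]
        rcases hc _ (mem_edges_iff.2 huv) with h | h
        · rw [if_pos ⟨huv, h⟩, h]
          ring
        · rw [if_neg (fun h' => by have := h'.2; linarith), h]
          ring
    simp_rw [h2, Finset.sum_sub_distrib, hx.sum_pairWeight]
    rw [h1, Finset.sum_const, Finset.card_univ, nsmul_eq_mul, lpCost]
    ring

lemma card_le_lpCost (hx : IsSubtourFeasible x) {c : Sym2 V → ℝ}
    (hc : ∀ e ∈ edges V, c e = 1 ∨ c e = 2) : (Fintype.card V : ℝ) ≤ lpCost c x := by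
  classical
  have h := (hx.isFracTour hc).slack
  have h' : 0 ≤ ∑ u, ∑ v, (if (costOneGraph c).Adj u v then 0 else pairWeight x u v) :=
    Finset.sum_nonneg fun u _ => Finset.sum_nonneg fun v _ => by
      split_ifs
      exacts [le_rfl, hx.pairWeight_nonneg u v]
  have h'' : 0 ≤ 2 * (lpCost c x - Fintype.card V) := by
    rw [← h]
    convert h'
  linarith

/-- With three cities, the only feasible solution is the triangle. -/
lemma eq_one_of_card_eq_three (hx : IsSubtourFeasible x) (hV : Fintype.card V = 3) {e : Sym2 V}
    (he : e ∈ edges V) : x e = 1 := by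
  refine le_antisymm (hx.bounds e he).2 ?_
  induction e with
  | _ a b =>
    have hab := mem_edges_iff.1 he
    have h := hx.sum_pairWeight a
    rw [← Finset.sum_add_sum_compl {a, b}, Finset.sum_pair hab, pairWeight_self,
      pairWeight_of_ne x hab] at h
    have h2 : ({a, b} : Finset V)ᶜ.card = 1 := by
      rw [Finset.card_compl, Finset.card_pair hab, hV]
    obtain ⟨d, hd⟩ := Finset.card_eq_one.1 h2
    rw [hd, Finset.sum_singleton] at h
    have := hx.pairWeight_le_one a d
    linarith

end IsSubtourFeasible

/-- The uniform solution gives a set of s vertices the cut value 2s(n - s)/(n - 1). -/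
lemma isSubtourFeasible_const (hV : 3 ≤ Fintype.card V) :
    IsSubtourFeasible (fun _ : Sym2 V => (2 / (Fintype.card V - 1) : ℝ)) := by
  have hn : (3 : ℝ) ≤ Fintype.card V := by exact_mod_cast hV
  have hpos : (0 : ℝ) < Fintype.card V - 1 := by linarith
  have hsum : ∀ S : Finset V, ∑ e ∈ cut S, (2 / (Fintype.card V - 1) : ℝ) =
      2 * (S.card * (Fintype.card V - S.card)) / (Fintype.card V - 1) := by
    intro S
    rw [sum_cut S fun _ => (2 / (Fintype.card V - 1) : ℝ)]
    simp only [Finset.sum_const, nsmul_eq_mul, Finset.card_compl]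
    rw [Nat.cast_sub (Finset.card_le_univ S)]
    ring
  refine ⟨fun i => ?_, fun S h1 h2 => ?_, fun e _ => ⟨by positivity, ?_⟩⟩
  · rw [hsum, Finset.card_singleton, div_eq_iff hpos.ne']
    push_cast
    ring
  · rw [hsum, le_div_iff₀ hpos]
    have h1' : (3 : ℝ) ≤ S.card := by exact_mod_cast h1
    have h2' : (S.card : ℝ) + 3 ≤ Fintype.card V := by exact_mod_cast h2
    nlinarith
  · rw [div_le_one hpos]
    linarith

lemma lpValues_nonempty (c : Sym2 V → ℝ) (hV : 3 ≤ Fintype.card V) : (lpValues c).Nonempty :=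
  ⟨_, _, isSubtourFeasible_const hV, rfl⟩

/-- The diagonal entries of `x` are unconstrained and would make the feasible set unbounded, so they
are fixed to 0; this does not change the objective values. -/
lemma isCompact_feasible :
    IsCompact {x : Sym2 V → ℝ | IsSubtourFeasible x ∧ ∀ e ∉ edges V, x e = 0} := by
  refine (isCompact_univ_pi fun _ => isCompact_Icc (a := (0 : ℝ)) (b := 1)).of_isClosed_subset
    ?_ ?_
  · have : {x : Sym2 V → ℝ | IsSubtourFeasible x ∧ ∀ e ∉ edges V, x e = 0} =
        {x | (∀ i : V, ∑ e ∈ cut {i}, x e = 2) ∧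
          (∀ S : Finset V, 3 ≤ S.card → S.card + 3 ≤ Fintype.card V → 2 ≤ ∑ e ∈ cut S, x e) ∧
          (∀ e ∈ edges V, 0 ≤ x e ∧ x e ≤ 1) ∧ ∀ e ∉ edges V, x e = 0} := by
      ext x
      exact ⟨fun h => ⟨h.1.1, h.1.2, h.1.3, h.2⟩, fun h => ⟨⟨h.1, h.2.1, h.2.2.1⟩, h.2.2.2⟩⟩
    rw [this]
    simp only [Set.ofPred_and, Set.ofPred_forall]
    refine .inter ?_ (.inter ?_ (.inter ?_ ?_))
    · exact isClosed_iInter fun i => isClosed_eq (by fun_prop) (by fun_prop)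
    · exact isClosed_iInter fun S => isClosed_iInter fun _ => isClosed_iInter fun _ =>
        isClosed_le (by fun_prop) (by fun_prop)
    · exact isClosed_iInter fun e => isClosed_iInter fun _ =>
        (isClosed_le (by fun_prop) (by fun_prop)).inter (isClosed_le (by fun_prop) (by fun_prop))
    · exact isClosed_iInter fun e => isClosed_iInter fun _ =>
        isClosed_eq (by fun_prop) (by fun_prop)
  · rintro x ⟨hx, hx'⟩ e -
    by_cases he : e ∈ edges V
    · exact hx.bounds e he
    · rw [hx' e he]
      simp

lemma IsSubtourFeasible.congr {x y : Sym2 V → ℝ} (hx : IsSubtourFeasible x)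
    (h : ∀ e ∈ edges V, y e = x e) : IsSubtourFeasible y := by
  have hsum : ∀ S : Finset V, ∑ e ∈ OneTwoTSP.cut S, y e = ∑ e ∈ OneTwoTSP.cut S, x e :=
    fun S => Finset.sum_congr rfl fun e he => h e (cut_subset_edges S he)
  refine ⟨fun i => ?_, fun S h1 h2 => ?_, fun e he => ?_⟩
  · rw [hsum, hx.degree]
  · rw [hsum]
    exact hx.subtour S h1 h2
  · rw [h e he]
    exact hx.bounds e he

lemma lpValues_eq_image (c : Sym2 V → ℝ) :
    lpValues c = lpCost c '' {x | IsSubtourFeasible x ∧ ∀ e ∉ edges V, x e = 0} := by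
  ext t
  constructor
  · rintro ⟨x, hx, rfl⟩
    have h : ∀ e ∈ edges V, (if e ∈ edges V then x e else 0) = x e := fun e he => if_pos he
    refine ⟨fun e => if e ∈ edges V then x e else 0, ⟨hx.congr h, fun e he => if_neg he⟩, ?_⟩
    exact Finset.sum_congr rfl fun e he => congrArg (c e * ·) (h e he)
  · rintro ⟨x, ⟨hx, -⟩, rfl⟩
    exact ⟨x, hx, rfl⟩

lemma isLeast_optSubtour (c : Sym2 V → ℝ) (hV : 3 ≤ Fintype.card V) :
    IsLeast (lpValues c) (optSubtour c) := by
  have hcomp : IsCompact (lpValues c) := by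
    rw [lpValues_eq_image]
    refine isCompact_feasible.image ?_
    unfold lpCost
    fun_prop
  exact hcomp.isLeast_sInf (lpValues_nonempty c hV)

lemma optTour_le_of_card_eq_three {c x : Sym2 V → ℝ} (hV : Fintype.card V = 3)
    (hc : ∀ e ∈ edges V, c e = 1 ∨ c e = 2) (hx : IsSubtourFeasible x) :
    optTour c ≤ lpCost c x := by
  obtain ⟨v, p, hp, hcost⟩ := (isLeast_optTour hV.ge hc).1
  have h1 : lpCost c x = ∑ e ∈ edges V, c e :=
    Finset.sum_congr rfl fun e he => by rw [hx.eq_one_of_card_eq_three hV he, mul_one]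
  rw [← hcost, h1, walkCost, ← List.sum_toFinset _ hp.isCycle.edges_nodup]
  refine Finset.sum_le_sum_of_subset_of_nonneg ?_ fun e he _ => ?_
  · intro e he
    rw [SimpleGraph.mem_edgeFinset]
    exact p.edges_subset_edgeSet (List.mem_toFinset.1 he)
  · rcases hc e he with h | h <;> rw [h] <;> norm_num

lemma optTour_le {c x : Sym2 V → ℝ} (hV : 3 ≤ Fintype.card V)
    (hc : ∀ e ∈ edges V, c e = 1 ∨ c e = 2) (hx : IsSubtourFeasible x) :
    optTour c ≤ 19 / 15 * lpCost c x := by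
  have hcard := hx.card_le_lpCost hc
  have hnn : (0 : ℝ) ≤ Fintype.card V := Nat.cast_nonneg _
  -- Three cities are treated apart: the matching argument needs at least four vertices, whereas
  -- here the LP is exact.
  rcases hV.eq_or_lt with h3 | h4
  · have := optTour_le_of_card_eq_three h3.symm hc hx
    linarith
  · obtain ⟨l, hl, hmem, hbreaks⟩ :=
      (hx.isFracTour hc).exists_list_breaks_le h4 (by linarith)
    obtain ⟨v, p, hp, hcost⟩ := exists_tour_of_list hV hc hl hmem
    have := (isLeast_optTour hV hc).2 ⟨v, p, hp, rfl⟩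
    linarith

end

end OneTwoTSP

theorem mainTheorem1 {V : Type*} [Fintype V] [DecidableEq V] (hV : 3 ≤ Fintype.card V)
    (c : Sym2 V → ℝ) (hc : ∀ e ∈ OneTwoTSP.edges V, c e = 1 ∨ c e = 2) :
    IsLeast (OneTwoTSP.tourCosts c) (OneTwoTSP.optTour c) ∧
    IsLeast (OneTwoTSP.lpValues c) (OneTwoTSP.optSubtour c) ∧
    OneTwoTSP.optTour c ≤ 19 / 15 * OneTwoTSP.optSubtour c := by
  refine ⟨OneTwoTSP.isLeast_optTour hV hc, OneTwoTSP.isLeast_optSubtour c hV, ?_⟩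
  obtain ⟨x, hx, h⟩ := (OneTwoTSP.isLeast_optSubtour c hV).1
  rw [← h]
  exact OneTwoTSP.optTour_le hV hc hx
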